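/- Let $\mathbb{H}$ be the real vector space of $n\times n$ complex Hermitian matrices, with the inner product $\langle X,Y\rangle=\operatorname{tr}(XY)$ and the Hilbert-Schmidt norm $\|X\|_2=(\operatorname{tr}X^2)^{1/2}$, and let $\mathbb{P}\subset\mathbb{H}$ be the open set of positive definite matrices. Let $0<t<1$, let $A_1,\dots,A_m\in\mathbb{P}$, and let $w_1,\dots,w_m\ge 0$ be weights with $\sum_j w_j=1$. For $X\in\mathbb{P}$ put $$\varphi_t(X)=\sum_{j=1}^m w_j\Big[\operatorname{tr}\big((1-t)A_j+tX\big)-\operatorname{tr}\big(A_j^{\frac{1-t}{2t}}XA_j^{\frac{1-t}{2t}}\big)^{t}\Big].$$ Then $\varphi_t$ is nonnegative, infinitely differentiable and strictly convex on $\mathbb{P}$, and it has a unique minimizer $X_*$ in $\mathbb{P}$. The minimizer is a fixed point of the map $$X\mapsto\sum_{j=1}^m w_j\big(X^{1/2}A_j^{\frac{1-t}{t}}X^{1/2}\big)^{t}.$$ Moreover, let $\alpha,\beta>0$ be such that $\alpha I\le A_j\le\beta I$ for all $j$, and let $[\alpha I,\beta I]=\{X\in\mathbb{H}:\alpha I\le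 X\le\beta I\}$. Then $X_*\in[\alpha I,\beta I]$, and on $[\alpha I,\beta I]$ the function $\varphi_t$ is $k_2$-smooth with $k_2=t(1-t)\beta^{1-t}\alpha^{t-2}$ and $k_1$-strongly convex with $k_1=t(1-t)\beta^{t-2}\alpha^{1-t}>0$; that is, for all $X,Y\in[\alpha I,\beta I]$, $$\|\nabla\varphi_t(X)-\nabla\varphi_t(Y)\|_2\le k_2\|X-Y\|_2$$ and $$\varphi_t(Y)-\varphi_t(X)-\langle\nabla\varphi_t(X),Y-X\rangle\ge\frac{k_1}{2}\|X-Y\|_2^2 .$$ -/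

import Mathlib

open scoped MatrixOrder ComplexOrder Gradient ContDiff

noncomputable section

namespace SandwichedEntropy

/-- The real vector space of `n × n` complex Hermitian matrices. -/
def Herm (n : ℕ) : Type :=
  selfAdjoint.submodule ℝ (Matrix (Fin n) (Fin n) ℂ)

namespace Herm

variable {n : ℕ}

instance : AddCommGroup (Herm n) :=
  inferInstanceAs (AddCommGroup (selfAdjoint.submodule ℝ (Matrix (Fin n) (Fin n) ℂ)))

instance : Module ℝ (Herm n) :=
  inferInstanceAs (Module ℝ (selfAdjoint.submodule ℝ (Matrix (Fin n) (Fin n) ℂ)))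

instance : FiniteDimensional ℝ (Herm n) :=
  inferInstanceAs (FiniteDimensional ℝ (selfAdjoint.submodule ℝ (Matrix (Fin n) (Fin n) ℂ)))

/-- The underlying matrix of a Hermitian matrix, as a real-linear map. -/
def toMat : Herm n →ₗ[ℝ] Matrix (Fin n) (Fin n) ℂ :=
  (selfAdjoint.submodule ℝ (Matrix (Fin n) (Fin n) ℂ)).subtype

instance : CoeOut (Herm n) (Matrix (Fin n) (Fin n) ℂ) := ⟨fun X => toMat X⟩

theorem toMat_injective : Function.Injective (toMat : Herm n → Matrix (Fin n) (Fin n) ℂ) :=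
  Subtype.val_injective

theorem isHermitian (X : Herm n) : (X : Matrix (Fin n) (Fin n) ℂ).IsHermitian :=
  X.2

/-- A matrix that is Hermitian, as an element of `Herm n`. -/
def ofMat (M : Matrix (Fin n) (Fin n) ℂ) (hM : M.IsHermitian) : Herm n := ⟨M, hM⟩

@[simp]
theorem toMat_ofMat (M : Matrix (Fin n) (Fin n) ℂ) (hM : M.IsHermitian) :
    toMat (ofMat M hM) = M := rfl

/-- The Hilbert-Schmidt inner product `⟨X, Y⟩ = tr (X Y)` on Hermitian matrices
(this trace is a real number). -/
abbrev innerCore (n : ℕ) : InnerProductSpace.Core ℝ (Herm n) where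
  inner X Y := (Matrix.trace ((X : Matrix (Fin n) (Fin n) ℂ) * (Y : Matrix (Fin n) (Fin n) ℂ))).re
  conj_inner_symm X Y := by
    simp [Matrix.trace_mul_comm (toMat X)]
  re_inner_nonneg X := by
    have h := (Matrix.posSemidef_conjTranspose_mul_self (toMat X)).trace_nonneg
    rw [(isHermitian X).eq] at h
    exact (Complex.le_def.1 h).1
  add_left X Y Z := by simp [add_mul]
  smul_left X Y r := by simp
  definite X hX := by
    have h := (Matrix.posSemidef_conjTranspose_mul_self (toMat X)).trace_nonneg
    have h0 : Matrix.trace ((toMat X).conjTranspose * toMat X) = 0 := by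
      apply Complex.ext
      · rw [(isHermitian X).eq]; exact hX
      · exact ((Complex.le_def.1 h).2).symm
    exact toMat_injective (by simpa using Matrix.trace_conjTranspose_mul_self_eq_zero_iff.1 h0)

/-- The norm is the Hilbert-Schmidt norm `‖X‖₂ = (tr X²)^{1/2}`. -/
instance : NormedAddCommGroup (Herm n) := (innerCore n).toNormedAddCommGroup

instance : InnerProductSpace ℝ (Herm n) := InnerProductSpace.ofCore (innerCore n).toCore

instance : CompleteSpace (Herm n) := FiniteDimensional.complete ℝ (Herm n)

theorem inner_def (X Y : Herm n) :
    inner ℝ X Y =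
      (Matrix.trace ((X : Matrix (Fin n) (Fin n) ℂ) * (Y : Matrix (Fin n) (Fin n) ℂ))).re := rfl

end Herm

/-- The set `ℙ` of positive definite matrices, inside the space of Hermitian matrices. -/
def Pos (n : ℕ) : Set (Herm n) := {X | (X : Matrix (Fin n) (Fin n) ℂ).PosDef}

/-- The interval `[αI, βI] = {X : αI ≤ X ≤ βI}` for the Loewner order. -/
def loewnerIcc (n : ℕ) (α β : ℝ) : Set (Herm n) :=
  {X | α • (1 : Matrix (Fin n) (Fin n) ℂ) ≤ (X : Matrix (Fin n) (Fin n) ℂ) ∧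
    (X : Matrix (Fin n) (Fin n) ℂ) ≤ β • (1 : Matrix (Fin n) (Fin n) ℂ)}

/-- The parametrised fidelity `F_t(A, X) = tr (A^{(1-t)/2t} X A^{(1-t)/2t})^t`
(this trace is a real number); the powers of positive semidefinite matrices are those of the
functional calculus. -/
def fidelity {n : ℕ} (t : ℝ) (A X : Herm n) : ℝ :=
  (Matrix.trace
    (((A : Matrix (Fin n) (Fin n) ℂ) ^ ((1 - t) / (2 * t)) * (X : Matrix (Fin n) (Fin n) ℂ) *
      (A : Matrix (Fin n) (Fin n) ℂ) ^ ((1 - t) / (2 * t))) ^ t)).re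

/-- The objective function
`φ_t(X) = ∑ w_j [tr ((1-t) A_j + t X) - tr (A_j^{(1-t)/2t} X A_j^{(1-t)/2t})^t]`. -/
def phi {n m : ℕ} (w : Fin m → ℝ) (A : Fin m → Herm n) (t : ℝ) (X : Herm n) : ℝ :=
  ∑ j, w j *
    ((Matrix.trace ((1 - t) • (A j : Matrix (Fin n) (Fin n) ℂ) +
        t • (X : Matrix (Fin n) (Fin n) ℂ))).re
      - fidelity t (A j) X)

/-- The map `X ↦ ∑ w_j (X^{1/2} A_j^{(1-t)/t} X^{1/2})^t`. -/
def fixMap {n m : ℕ} (w : Fin m → ℝ) (A : Fin m → Herm n) (t : ℝ) (X : Herm n) :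
    Matrix (Fin n) (Fin n) ℂ :=
  ∑ j, w j •
    ((X : Matrix (Fin n) (Fin n) ℂ) ^ (1 / 2 : ℝ) *
      (A j : Matrix (Fin n) (Fin n) ℂ) ^ ((1 - t) / t) *
      (X : Matrix (Fin n) (Fin n) ℂ) ^ (1 / 2 : ℝ)) ^ t

/-- The Bregman distance `D_f(Y, X) = f(Y) - f(X) - ⟨∇f(X), Y - X⟩`. -/
def bregman {n : ℕ} (f : Herm n → ℝ) (Y X : Herm n) : ℝ :=
  f Y - f X - inner ℝ (∇ f X) (Y - X)

/-- `f` is `k`-strongly convex on `K` (with `k > 0`): `f` is differentiable at the points of `K`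
and `D_f(Y, X) ≥ (k/2) ‖X - Y‖₂²` on `K`. -/
def IsStronglyConvexOn {n : ℕ} (f : Herm n → ℝ) (k : ℝ) (K : Set (Herm n)) : Prop :=
  0 < k ∧ (∀ X ∈ K, DifferentiableAt ℝ f X) ∧
    ∀ X ∈ K, ∀ Y ∈ K, k / 2 * ‖X - Y‖ ^ 2 ≤ bregman f Y X

/-- `f` is `k`-smooth on `K`: `f` is differentiable at the points of `K` and `∇f` is `k`-Lipschitz
on `K`. -/
def IsSmoothOn {n : ℕ} (f : Herm n → ℝ) (k : ℝ) (K : Set (Herm n)) : Prop :=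
  (∀ X ∈ K, DifferentiableAt ℝ f X) ∧
    ∀ X ∈ K, ∀ Y ∈ K, ‖∇ f X - ∇ f Y‖ ≤ k * ‖X - Y‖

end SandwichedEntropy

end

/-! Write `F` for the fidelity, `s = (1-t)/(2t)` and `G(X) = t A^s (A^s X A^s)^(t-1) A^s`. Klein's
inequality for the concave power `x^t` (`trace_rpow_le_tangent`) bounds `F(A, ·)` above by its
tangent at `X` with slope `G(X)`. Since `F` is smooth (locally a binomial series in `X`), `G` must
be its gradient, and `φ_t` lies above its tangents. At `X = A` the tangent of `F` is exactly the
affine part of `φ_t`, which gives nonnegativity.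

The constants come from `x^(t-1) = c ∫ l^(t-1) (l+x)⁻¹ dl`. With `D = A^(-(1-t)/t)`, so that `A^s D
A^s = 1`, the gradient is `t c ∫ l^(t-1) (l D + X)⁻¹ dl`, and a difference of gradients has
integrand `l^(t-1) L⁻¹ (Y-X) K⁻¹` with `L = l D + X`, `K = l D + Y`. On the interval, `L` and `K`
lie between the scalars `l β^(-(1-t)/t) + α` and `l α^(-(1-t)/t) + β`. The resulting scalar
integrals are explicit and equal `k₂` and `k₁` after multiplication by `t c`. Strong monotonicity of
the gradient integrates along segments to strong convexity. Finitely many positive definite matrices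
share an interval `[R⁻¹ I, R I]`, so strict convexity holds on all of `ℙ`.

For the minimizer, take a minimum `X` over the compact interval. The fixed-point map sends `X` to
some `Y` in the interval, so `⟨∇φ(X), Y - X⟩ ≥ 0`. But `X^(1/2) ∇φ(X) X^(1/2) = t (X - Y)` turns
this product into `-t⁻¹ ‖X^(1/4) ∇φ(X) X^(1/4)‖²`. Hence `∇φ(X) = 0`: `X` is a fixed point and, by
convexity, a global minimizer. -/

noncomputable section

namespace SandwichedEntropy

/-! ### Traces of functional calculus as sums over eigenvalues. -/

section TraceFormulas

variable {ι : Type*} [Fintype ι] [DecidableEq ι]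

/-- The trace of a functional calculus against a fixed matrix is a fixed linear combination of the
values at the eigenvalues. -/
theorem exists_trace_mul_cfc (Z : Matrix ι ι ℂ) {Y : Matrix ι ι ℂ} (hY : Y.IsHermitian) :
    ∃ q : ι → ℝ, ∀ f : ℝ → ℝ, (Matrix.trace (Z * cfc f Y)).re = ∑ i, f (hY.eigenvalues i) * q i := by
  set U : Matrix ι ι ℂ := (hY.eigenvectorUnitary : Matrix ι ι ℂ) with hU
  refine ⟨fun i => ((star U * Z * U) i i).re, fun f => ?_⟩
  rw [hY.cfc_eq, Matrix.IsHermitian.cfc, Unitary.conjStarAlgAut_apply, ← hU, ← mul_assoc,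
    Matrix.trace_mul_comm, ← mul_assoc, ← mul_assoc, Matrix.trace]
  simp [Matrix.mul_diagonal, mul_comm]

/-- The weights are the squared overlaps of the two eigenbases. They are nonnegative and do not
depend on `g` and `f`, so scalar inequalities in two variables pass to traces term by term. -/
theorem exists_trace_cfc_mul_cfc {P Q : Matrix ι ι ℂ} (hP : P.IsHermitian) (hQ : Q.IsHermitian) :
    ∃ S : ι → ι → ℝ, (∀ i j, 0 ≤ S i j) ∧ ∀ g f : ℝ → ℝ,
      (Matrix.trace (cfc g P * cfc f Q)).re =
        ∑ i, ∑ j, g (hP.eigenvalues i) * f (hQ.eigenvalues j) * S i j := by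
  set U : Matrix ι ι ℂ := (hP.eigenvectorUnitary : Matrix ι ι ℂ) with hU
  set V : Matrix ι ι ℂ := (hQ.eigenvectorUnitary : Matrix ι ι ℂ) with hV
  refine ⟨fun i j => Complex.normSq ((star U * V) i j), fun i j => Complex.normSq_nonneg _,
    fun g f => ?_⟩
  rw [hP.cfc_eq, hQ.cfc_eq, Matrix.IsHermitian.cfc, Matrix.IsHermitian.cfc,
    Unitary.conjStarAlgAut_apply, Unitary.conjStarAlgAut_apply, ← hU, ← hV]
  set D := Matrix.diagonal (RCLike.ofReal ∘ g ∘ hP.eigenvalues : ι → ℂ)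
  set E := Matrix.diagonal (RCLike.ofReal ∘ f ∘ hQ.eigenvalues : ι → ℂ)
  have h : U * D * star U * (V * E * star V) = U * (D * (star U * V) * E * star V) := by
    simp only [mul_assoc]
  have h2 : D * (star U * V) * E * star V * U = (D * (star U * V) * E) * star (star U * V) := by
    simp only [mul_assoc, star_mul, star_star]
  rw [h, Matrix.trace_mul_comm, h2, Matrix.trace]
  simp only [D, E, Matrix.diag_apply, Matrix.mul_apply (N := star (star U * V)), Matrix.mul_diagonal,
    Matrix.diagonal_mul, Matrix.star_apply, Complex.re_sum, Function.comp_apply]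
  refine Finset.sum_congr rfl fun i _ => Finset.sum_congr rfl fun j _ => ?_
  simp [Complex.normSq_apply]
  ring

end TraceFormulas

/-! ### Real powers of positive definite matrices and Klein's inequality. -/

section MatrixPowers

variable {ι : Type*} [Fintype ι] [DecidableEq ι]

theorem rpow_isHermitian (P : Matrix ι ι ℂ) (r : ℝ) : (P ^ r).IsHermitian :=
  (Matrix.nonneg_iff_posSemidef.1 (CFC.rpow_nonneg (a := P) (y := r))).isHermitian

theorem rpow_posDef {P : Matrix ι ι ℂ} (hP : P.PosDef) (r : ℝ) : (P ^ r).PosDef :=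
  Matrix.isStrictlyPositive_iff_posDef.1 (hP.isStrictlyPositive.rpow P r)

theorem rpow_eq_cfc {P : Matrix ι ι ℂ} (hP : P.PosSemidef) (r : ℝ) :
    P ^ r = cfc (fun x : ℝ => x ^ r) P :=
  CFC.rpow_eq_cfc_real (Matrix.nonneg_iff_posSemidef.2 hP)

/-- Any real function is continuous on the (finite) spectrum of a matrix. -/
theorem continuousOn_spectrum (f : ℝ → ℝ) {P : Matrix ι ι ℂ} (hP : P.IsHermitian) :
    ContinuousOn f (spectrum ℝ P) := by
  rw [hP.spectrum_real_eq_range_eigenvalues]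
  exact (Set.finite_range _).continuousOn f

theorem mem_spectrum_pos {P : Matrix ι ι ℂ} (hP : P.PosDef) {x : ℝ} (hx : x ∈ spectrum ℝ P) :
    0 < x := by
  rw [hP.isHermitian.spectrum_real_eq_range_eigenvalues] at hx
  obtain ⟨i, rfl⟩ := hx
  exact hP.eigenvalues_pos i

/-- Klein's inequality for `x ↦ x ^ t`. -/
theorem trace_rpow_le_tangent {P Q : Matrix ι ι ℂ} (hP : P.PosDef) (hQ : Q.PosDef) {t : ℝ}
    (ht0 : 0 ≤ t) (ht1 : t ≤ 1) :
    (Matrix.trace (Q ^ t)).re ≤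
      (Matrix.trace (P ^ t)).re + t * (Matrix.trace (P ^ (t - 1) * (Q - P))).re := by
  obtain ⟨S, hS, hf⟩ := exists_trace_cfc_mul_cfc hP.isHermitian hQ.isHermitian
  have hPs : IsSelfAdjoint P := hP.isHermitian
  have hQs : IsSelfAdjoint Q := hQ.isHermitian
  have h1 := hf (fun _ => 1) (fun x => x ^ t)
  have h2 := hf (fun x => x ^ t) (fun _ => 1)
  have h3 := hf (fun x => x ^ (t - 1)) (fun x => x)
  rw [cfc_const_one ℝ P, one_mul, ← rpow_eq_cfc hQ.posSemidef] at h1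
  rw [cfc_const_one ℝ Q, mul_one, ← rpow_eq_cfc hP.posSemidef] at h2
  rw [cfc_id' ℝ Q, ← rpow_eq_cfc hP.posSemidef] at h3
  have h4 : P ^ (t - 1) * P = P ^ t := by
    nth_rewrite 2 [← CFC.rpow_one P hP.isStrictlyPositive.nonneg]
    rw [← CFC.rpow_add hP.isUnit]
    simp
  rw [mul_sub, h4, Matrix.trace_sub, Complex.sub_re, h1, h2, h3, ← Finset.sum_sub_distrib,
    Finset.mul_sum, ← Finset.sum_add_distrib]
  refine Finset.sum_le_sum fun i _ => ?_
  rw [← Finset.sum_sub_distrib, Finset.mul_sum, ← Finset.sum_add_distrib]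
  refine Finset.sum_le_sum fun j _ => ?_
  have hp := hP.eigenvalues_pos i
  have hq := hQ.eigenvalues_pos j
  set p := hP.isHermitian.eigenvalues i
  set q := hQ.isHermitian.eigenvalues j
  -- Bernoulli's inequality at `q / p`; multiplied by `p ^ t` it is the tangent bound for `x ^ t` at
  -- `p`.
  have hb := rpow_one_add_le_one_add_mul_self (s := q / p - 1)
    (by have := div_pos hq hp; linarith) ht0 ht1
  rw [add_sub_cancel, Real.div_rpow hq.le hp.le, div_le_iff₀ (Real.rpow_pos_of_pos hp t)] at hb
  have hb' : q ^ t ≤ p ^ t + t * (p ^ (t - 1) * q - p ^ t) := by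
    rw [Real.rpow_sub_one hp.ne']
    calc q ^ t ≤ _ := hb
      _ = _ := by field_simp
  nlinarith [mul_le_mul_of_nonneg_right hb' (hS i j)]

theorem resolvent_eq_cfc {P : Matrix ι ι ℂ} (hP : P.PosDef) {l : ℝ} (hl : 0 < l) :
    (l • 1 + P)⁻¹ = cfc (fun x : ℝ => (l + x)⁻¹) P := by
  have hPs : IsSelfAdjoint P := hP.isHermitian
  refine Matrix.inv_eq_right_inv ?_
  have h : l • 1 + P = cfc (fun x : ℝ => l + x) P := by
    rw [cfc_const_add l (fun x => x) P (continuousOn_spectrum _ hPs), cfc_id' ℝ P,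
      Algebra.algebraMap_eq_smul_one]
  rw [h, ← cfc_mul _ _ P (continuousOn_spectrum _ hPs) (continuousOn_spectrum _ hPs),
    ← cfc_const_one ℝ P]
  refine cfc_congr fun x hx => ?_
  have := mem_spectrum_pos hP hx
  exact mul_inv_cancel₀ (by positivity)

theorem rpow_conj_unitary (u : unitary (Matrix ι ι ℂ)) {Q : Matrix ι ι ℂ} (hQ : Q.PosDef) (t : ℝ) :
    ((u : Matrix ι ι ℂ) * Q * star (u : Matrix ι ι ℂ)) ^ t =
      (u : Matrix ι ι ℂ) * Q ^ t * star (u : Matrix ι ι ℂ) := by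
  have hu : IsUnit (u : Matrix ι ι ℂ) := (Unitary.toUnits u).isUnit
  have hQ' := (Matrix.IsUnit.posDef_star_right_conjugate_iff hu).2 hQ
  have hQs : IsSelfAdjoint Q := hQ.isHermitian
  rw [rpow_eq_cfc hQ'.posSemidef, rpow_eq_cfc hQ.posSemidef]
  have hcont : Continuous (Unitary.conjStarAlgAut ℝ (Matrix ι ι ℂ) u) := by
    change Continuous fun x : Matrix ι ι ℂ => (u : Matrix ι ι ℂ) * x * star (u : Matrix ι ι ℂ)
    fun_prop
  have h := StarAlgHomClass.map_cfc (S := ℝ) (Unitary.conjStarAlgAut ℝ (Matrix ι ι ℂ) u)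
    (fun x : ℝ => x ^ t) Q (continuousOn_spectrum _ hQs) hcont hQs
    (by simpa using hQ'.isHermitian.isSelfAdjoint)
  simpa using h.symm

/-- `K* (K K*)^(t-1) K = (K* K)^t` for invertible `K`. -/
theorem star_mul_rpow_mul {K : Matrix ι ι ℂ} (hK : IsUnit K) (t : ℝ) :
    star K * (K * star K) ^ (t - 1) * K = (star K * K) ^ t := by
  have hQ : (K * star K).PosDef := by
    simpa using (Matrix.IsUnit.posDef_star_right_conjugate_iff hK).2 Matrix.PosDef.one
  set Q := K * star K with hQdef
  have hQu := hQ.isUnit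
  have hQ0 := hQ.isStrictlyPositive.nonneg
  set S := Q ^ (-(1 / 2) : ℝ) with hS
  have hSs : star S = S := rpow_isHermitian _ _
  have hSQS : S * Q * S = 1 := by
    nth_rewrite 1 [← CFC.rpow_one Q hQ0]
    rw [hS, ← CFC.rpow_add hQu, ← CFC.rpow_add hQu, ← CFC.rpow_zero Q hQ0]
    norm_num
  have hSS : S * Q ^ t * S = Q ^ (t - 1) := by
    rw [hS, ← CFC.rpow_add hQu, ← CFC.rpow_add hQu]
    congr 1
    ring
  have hVV : star (star K * S) * (star K * S) = 1 := by
    rw [star_mul, star_star, hSs, ← hSQS, hQdef]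
    simp only [mul_assoc]
  -- `star K * S` is the unitary polar factor of `star K`; it conjugates `K K*` into `K* K`.
  have hV : star K * S ∈ unitary (Matrix ι ι ℂ) :=
    Unitary.mem_iff.2 ⟨hVV, mul_eq_one_comm.1 hVV⟩
  have h := rpow_conj_unitary ⟨_, hV⟩ hQ t
  simp only [star_mul, star_star, hSs] at h
  rw [show star K * S * Q * (S * K) = star K * (S * Q * S) * K by simp only [mul_assoc], hSQS,
    mul_one] at h
  rw [h, ← hSS]
  simp only [mul_assoc]

theorem posDef_mul_mul {B X : Matrix ι ι ℂ} (hB : B.PosDef) (hX : X.PosDef) :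
    (B * X * B).PosDef := by
  have h := (Matrix.IsUnit.posDef_star_right_conjugate_iff hB.isUnit).2 hX
  rwa [show star B = B from hB.isHermitian] at h

end MatrixPowers

/-! ### Smoothness of the fidelity through the binomial series. -/

/-- In positive degree the terms are dominated in norm by those of the scalar series. Degree zero is
shifted away because `‖1‖` is not controlled in `𝔸`. -/
theorem one_le_radius_binomialSeries {𝕂 : Type*} [RCLike 𝕂] (𝔸 : Type*) [NormedRing 𝔸]
    [NormedAlgebra 𝕂 𝔸] (a : 𝕂) : 1 ≤ (binomialSeries 𝔸 a).radius := by
  refine ENNReal.le_of_forall_nnreal_lt fun r hr => ?_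
  have h1 := (binomialSeries 𝕂 a).summable_norm_mul_pow
    (hr.trans_le (binomialSeries_radius_ge_one (𝔸 := 𝕂) (a := a)))
  refine FormalMultilinearSeries.le_radius_of_summable_norm _ ?_
  rw [← summable_nat_add_iff 1] at h1 ⊢
  refine Summable.of_nonneg_of_le (fun n => by positivity) (fun n => ?_) h1
  refine mul_le_mul_of_nonneg_right ?_ (by positivity)
  calc ‖binomialSeries 𝔸 a (n + 1)‖ ≤ ‖Ring.choose a (n + 1)‖ :=
        FormalMultilinearSeries.ofScalars_norm_le _ _ _ (Nat.succ_pos n)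
    _ = ‖binomialSeries 𝕂 a (n + 1)‖ :=
        (FormalMultilinearSeries.ofScalars_norm 𝕂 (Ring.choose a ·) (n + 1)).symm

section PowerSmoothness

open scoped Matrix.Norms.L2Operator

section

variable {ι : Type*} [Fintype ι]

/-- The real part of the trace, as a continuous real-linear functional. -/
def reTrace : Matrix ι ι ℂ →L[ℝ] ℝ :=
  LinearMap.toContinuousLinearMap (Complex.reLm ∘ₗ Matrix.traceLinearMap ι ℝ ℂ)

theorem reTrace_apply (Z : Matrix ι ι ℂ) : reTrace Z = (Matrix.trace Z).re := rfl

variable [DecidableEq ι]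

theorem scaled_sub_one_eq_cfc {Y : Matrix ι ι ℂ} (hY : Y.IsHermitian) (M : ℝ) :
    M⁻¹ • Y - 1 = cfc (fun x : ℝ => M⁻¹ * x - 1) Y := by
  have hYs : IsSelfAdjoint Y := hY
  rw [cfc_sub _ _ Y (continuousOn_spectrum _ hY) (continuousOn_spectrum _ hY), cfc_const_one ℝ Y]
  congr 1
  exact (cfc_const_mul_id M⁻¹ Y).symm

theorem norm_scaled_sub_one_lt {Y : Matrix ι ι ℂ} (hY : Y.IsHermitian) {M : ℝ} :
    ‖M⁻¹ • Y - 1‖ < 1 ↔ ∀ x ∈ spectrum ℝ Y, |M⁻¹ * x - 1| < 1 := by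
  have hYs : IsSelfAdjoint Y := hY
  rw [scaled_sub_one_eq_cfc hY,
    norm_cfc_lt_iff _ Y one_pos (continuousOn_spectrum _ hY)]
  rfl

/-- This replaces the functional calculus, whose dependence on `Y` is hard to differentiate, by a
series analytic in `Y`. The trace of each term is a sum over eigenvalues, where the scalar binomial
series applies. -/
theorem trace_rpow_eq_sum {Y : Matrix ι ι ℂ} (hY : Y.PosDef) {M : ℝ} (hM : 0 < M) (t : ℝ)
    (hYM : ‖M⁻¹ • Y - 1‖ < 1) :
    (Matrix.trace (Y ^ t)).re =
      M ^ t * (Matrix.trace ((binomialSeries (Matrix ι ι ℂ) (t : ℂ)).sum (M⁻¹ • Y - 1))).re := by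
  have hH := hY.isHermitian
  have hYs : IsSelfAdjoint Y := hH
  have hmem : (M⁻¹ • Y - 1) ∈ Metric.eball 0 (binomialSeries (Matrix ι ι ℂ) (t : ℂ)).radius := by
    refine Metric.eball_subset_eball (one_le_radius_binomialSeries _ _) ?_
    rw [← ENNReal.ofReal_one, Metric.eball_ofReal]
    simpa using hYM
  have hs := (binomialSeries (Matrix ι ι ℂ) (t : ℂ)).hasSum hmem
  have hy : IsSelfAdjoint (M⁻¹ • Y - 1) := by
    rw [scaled_sub_one_eq_cfc hH]; exact cfc_predicate _ _
  obtain ⟨q, hq⟩ := exists_trace_mul_cfc 1 hH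
  have hterm : ∀ k : ℕ, reTrace (binomialSeries (Matrix ι ι ℂ) (t : ℂ) k fun _ => M⁻¹ • Y - 1) =
      ∑ i, (Ring.choose t k * (M⁻¹ * hH.eigenvalues i - 1) ^ k) * q i := by
    intro k
    have h := hq (fun x => (M⁻¹ * x - 1) ^ k)
    rw [cfc_pow _ k Y (continuousOn_spectrum _ hH), ← scaled_sub_one_eq_cfc hH, one_mul] at h
    rw [binomialSeries_apply, List.ofFn_const, List.prod_replicate, ← Complex.ofReal_choose,
      reTrace_apply, Matrix.trace_smul, smul_eq_mul, Complex.re_ofReal_mul, h, Finset.mul_sum]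
    exact Finset.sum_congr rfl fun i _ => (mul_assoc _ _ _).symm
  have hs1 := hs.mapL reTrace
  simp only [hterm] at hs1
  have hs2 : HasSum (fun k : ℕ => ∑ i, (Ring.choose t k * (M⁻¹ * hH.eigenvalues i - 1) ^ k) * q i)
      (∑ i, (1 + (M⁻¹ * hH.eigenvalues i - 1)) ^ t * q i) := by
    refine hasSum_sum fun i _ => HasSum.mul_right _ ?_
    have hx := (norm_scaled_sub_one_lt hH).1 hYM (hH.eigenvalues i)
      (by rw [hH.spectrum_real_eq_range_eigenvalues]; exact ⟨i, rfl⟩)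
    have h := (Real.one_add_rpow_hasFPowerSeriesOnBall_zero (a := t)).hasSum
      (y := M⁻¹ * hH.eigenvalues i - 1)
      (by rw [← ENNReal.ofReal_one, Metric.eball_ofReal]; simpa using hx)
    simpa only [binomialSeries_apply, List.ofFn_const, List.prod_replicate, smul_eq_mul,
      zero_add] using h
  rw [← reTrace_apply (binomialSeries _ _ |>.sum _), hs1.unique hs2, Finset.mul_sum,
    rpow_eq_cfc hY.posSemidef]
  have h := hq (fun x => x ^ t)
  rw [one_mul] at h
  rw [h]
  refine Finset.sum_congr rfl fun i _ => ?_
  have hp := hY.eigenvalues_pos i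
  rw [add_sub_cancel, Real.mul_rpow (by positivity) hp.le, Real.inv_rpow hM.le]
  have := Real.rpow_pos_of_pos hM t
  field_simp

theorem posDef_of_norm_scaled_sub_one_lt {Y : Matrix ι ι ℂ} (hY : Y.IsHermitian) {M : ℝ}
    (hM : 0 < M) (hYM : ‖M⁻¹ • Y - 1‖ < 1) : Y.PosDef := by
  refine hY.posDef_iff_eigenvalues_pos.2 fun i => ?_
  have hx := (norm_scaled_sub_one_lt hY).1 hYM (hY.eigenvalues i)
    (by rw [hY.spectrum_real_eq_range_eigenvalues]; exact ⟨i, rfl⟩)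
  have h := (abs_lt.1 hx).1
  have h2 : 0 < M⁻¹ * hY.eigenvalues i := by linarith
  exact pos_of_mul_pos_right h2 (inv_nonneg.2 hM.le)

theorem exists_norm_scaled_sub_one_lt {Y : Matrix ι ι ℂ} (hY : Y.PosDef) :
    ∃ M : ℝ, 0 < M ∧ ‖M⁻¹ • Y - 1‖ < 1 := by
  obtain ⟨b, hb⟩ := (Set.finite_range hY.isHermitian.eigenvalues).bddAbove
  -- A scale above every eigenvalue puts the scaled spectrum in `(0, 1]`; the `1` keeps it positive
  -- even when there are no eigenvalues.
  refine ⟨max b 1, by positivity, (norm_scaled_sub_one_lt hY.isHermitian).2 fun x hx => ?_⟩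
  have h0 := mem_spectrum_pos hY hx
  rw [hY.isHermitian.spectrum_real_eq_range_eigenvalues] at hx
  have hxb : x ≤ max b 1 := (hb hx).trans (le_max_left _ _)
  have hM : 0 < max b 1 := by positivity
  have h1 : (max b 1)⁻¹ * x ≤ 1 := by
    rw [inv_mul_le_iff₀ hM]; simpa using hxb
  have h2 : 0 < (max b 1)⁻¹ * x := by positivity
  rw [abs_lt]
  constructor <;> linarith

end

section HermSmooth
variable {n : ℕ}

theorem pos_isOpen : IsOpen (Pos n) := by
  rw [isOpen_iff_mem_nhds]
  intro X hX
  obtain ⟨M, hM, hlt⟩ := exists_norm_scaled_sub_one_lt hX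
  have hc : Continuous fun Y : Herm n => ‖M⁻¹ • Herm.toMat Y - 1‖ := by
    have := LinearMap.continuous_of_finiteDimensional (Herm.toMat (n := n))
    fun_prop
  filter_upwards [hc.continuousAt.eventually_lt_const hlt] with Y hY
  exact posDef_of_norm_scaled_sub_one_lt Y.isHermitian hM hY

/-- The real-linear map `X ↦ B X B`. -/
def sandwich (B : Matrix (Fin n) (Fin n) ℂ) : Herm n →L[ℝ] Matrix (Fin n) (Fin n) ℂ :=
  LinearMap.toContinuousLinearMap
    ((LinearMap.mulLeft ℝ B ∘ₗ LinearMap.mulRight ℝ B) ∘ₗ Herm.toMat)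

theorem sandwich_apply (B : Matrix (Fin n) (Fin n) ℂ) (X : Herm n) :
    sandwich B X = B * Herm.toMat X * B := (mul_assoc _ _ _).symm

theorem contDiffAt_fidelity {A X : Herm n} (hA : A ∈ Pos n) (hX : X ∈ Pos n) (t : ℝ) :
    ContDiffAt ℝ ∞ (fidelity t A) X := by
  set B := Herm.toMat A ^ ((1 - t) / (2 * t)) with hB
  have hBp : B.PosDef := rpow_posDef hA _
  obtain ⟨M, hM, hlt⟩ := exists_norm_scaled_sub_one_lt (posDef_mul_mul hBp hX)
  rw [← sandwich_apply] at hlt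
  have hc : ContDiff ℝ ∞ fun Y : Herm n => M⁻¹ • sandwich B Y - 1 := by fun_prop
  have hev : ∀ᶠ Y in nhds X, fidelity t A Y = M ^ t *
      reTrace ((binomialSeries (Matrix (Fin n) (Fin n) ℂ) (t : ℂ)).sum (M⁻¹ • sandwich B Y - 1)) := by
    filter_upwards [pos_isOpen.mem_nhds hX,
      hc.continuous.norm.continuousAt.eventually_lt_const hlt] with Y hY hYM
    rw [sandwich_apply] at hYM ⊢
    exact trace_rpow_eq_sum (posDef_mul_mul hBp hY) hM t hYM
  refine ContDiffAt.congr_of_eventuallyEq ?_ hev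
  have hr : ContDiff ℝ ∞ fun Z : Matrix (Fin n) (Fin n) ℂ => reTrace Z :=
    ContinuousLinearMap.contDiff (𝕜 := ℝ) (E := Matrix (Fin n) (Fin n) ℂ) (F := ℝ) reTrace
  refine contDiffAt_const.mul (hr.contDiffAt.fun_comp X ?_)
  have hrad := one_le_radius_binomialSeries (Matrix (Fin n) (Fin n) ℂ) (t : ℂ)
  have ha : AnalyticAt ℂ (binomialSeries (Matrix (Fin n) (Fin n) ℂ) (t : ℂ)).sum
      (M⁻¹ • sandwich B X - 1) := by
    refine ((binomialSeries (Matrix (Fin n) (Fin n) ℂ) (t : ℂ)).hasFPowerSeriesOnBall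
      (one_pos.trans_le hrad)).analyticAt_of_mem ?_
    refine Metric.eball_subset_eball hrad ?_
    rw [← ENNReal.ofReal_one, Metric.eball_ofReal]
    simpa using hlt
  exact ContDiffAt.comp X (ha.restrictScalars (𝕜 := ℝ)).contDiffAt hc.contDiffAt

end HermSmooth

end PowerSmoothness

/-! ### Scalar integrals behind the two constants. -/

open MeasureTheory Set in
theorem exists_resolvent_representation {t : ℝ} (ht0 : 0 < t) (ht1 : t < 1) :
    ∃ c : ℝ, 0 < c ∧ ∀ x : ℝ, 0 < x →
      IntegrableOn (fun l : ℝ => l ^ (t - 1) * (l + x)⁻¹) (Ioi 0) ∧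
      c * ∫ l in Ioi (0 : ℝ), l ^ (t - 1) * (l + x)⁻¹ = x ^ (t - 1) := by
  have ht : t ∈ Ioo (0 : ℝ) 1 := ⟨ht0, ht1⟩
  refine ⟨_, inv_pos.2 (Real.integral_rpowIntegrand₀₁_one_pos ht), fun x hx => ?_⟩
  have heq : ∀ l ∈ Ioi (0 : ℝ),
      x⁻¹ * Real.rpowIntegrand₀₁ t l x = l ^ (t - 1) * (l + x)⁻¹ := by
    intro l hl
    rw [Real.rpowIntegrand₀₁_eq_pow_div ht (le_of_lt hl) hx.le]
    field_simp
  refine ⟨IntegrableOn.congr_fun (Integrable.const_mul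
    (Real.integrableOn_rpowIntegrand₀₁_Ioi ht hx.le) x⁻¹) heq measurableSet_Ioi, ?_⟩
  rw [← setIntegral_congr_fun measurableSet_Ioi heq, integral_const_mul, mul_left_comm,
    ← Real.rpow_eq_const_mul_integral ht hx.le, Real.rpow_sub_one hx.ne']
  field_simp

-- Formally minus the `x`-derivative of the resolvent formula. It is obtained without
-- differentiating under the integral: `l^t / (l+x)` vanishes at both ends, and its derivative is a
-- combination of the two integrands.
open MeasureTheory Set in
theorem integral_resolvent_sq {t c x : ℝ} (ht0 : 0 < t) (ht1 : t < 1) (hx : 0 < x)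
    (hint : IntegrableOn (fun l : ℝ => l ^ (t - 1) * (l + x)⁻¹) (Ioi 0))
    (hc : c * ∫ l in Ioi (0 : ℝ), l ^ (t - 1) * (l + x)⁻¹ = x ^ (t - 1)) :
    IntegrableOn (fun l : ℝ => l ^ (t - 1) * ((l + x)⁻¹) ^ 2) (Ioi 0) ∧
      c * ∫ l in Ioi (0 : ℝ), l ^ (t - 1) * ((l + x)⁻¹) ^ 2 = (1 - t) * x ^ (t - 2) := by
  have hcont : ContinuousOn (fun l : ℝ => l ^ (t - 1) * ((l + x)⁻¹) ^ 2) (Ioi 0) := by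
    refine ContinuousOn.mul (fun l hl => (Real.continuousAt_rpow_const l _
      (Or.inl (ne_of_gt hl))).continuousWithinAt) (ContinuousOn.pow (ContinuousOn.inv₀ (by fun_prop)
      fun l hl => ?_) 2)
    exact (add_pos hl hx).ne'
  have hsq : IntegrableOn (fun l : ℝ => l ^ (t - 1) * ((l + x)⁻¹) ^ 2) (Ioi 0) := by
    refine (hint.mul_const x⁻¹).mono' (hcont.aestronglyMeasurable measurableSet_Ioi) ?_
    refine (ae_restrict_mem measurableSet_Ioi).mono fun l hl => ?_
    have hl : 0 < l := hl
    have h1 : (l + x)⁻¹ ≤ x⁻¹ := inv_anti₀ hx (by linarith)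
    rw [Real.norm_of_nonneg (by positivity), pow_two, ← mul_assoc]
    exact mul_le_mul_of_nonneg_left h1 (by positivity)
  refine ⟨hsq, ?_⟩
  have hder : ∀ l ∈ Ioi (0 : ℝ), HasDerivAt (fun l : ℝ => l ^ t * (l + x)⁻¹)
      ((t - 1) * (l ^ (t - 1) * (l + x)⁻¹) + x * (l ^ (t - 1) * ((l + x)⁻¹) ^ 2)) l := by
    intro l hl
    have hl : 0 < l := hl
    have hlx : l + x ≠ 0 := by positivity
    have h := (Real.hasDerivAt_rpow_const (x := l) (p := t) (Or.inl hl.ne')).mul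
      (((hasDerivAt_id l).add_const x).inv hlx)
    refine h.congr_deriv ?_
    simp only [id, Pi.inv_apply]
    rw [Real.rpow_sub_one hl.ne']
    field_simp
    ring
  have hlim : Filter.Tendsto (fun l : ℝ => l ^ t * (l + x)⁻¹) Filter.atTop (nhds 0) := by
    refine squeeze_zero' (g := fun l : ℝ => l ^ (-(1 - t))) ?_ ?_
      (tendsto_rpow_neg_atTop (by linarith))
    · filter_upwards [Filter.eventually_gt_atTop 0] with l hl
      positivity
    · filter_upwards [Filter.eventually_gt_atTop 0] with l hl
      rw [neg_sub, Real.rpow_sub_one hl.ne', div_eq_mul_inv]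
      exact mul_le_mul_of_nonneg_left (inv_anti₀ hl (by linarith)) (by positivity)
  have hcw : ContinuousWithinAt (fun l : ℝ => l ^ t * (l + x)⁻¹) (Ici 0) 0 := by
    refine ContinuousAt.continuousWithinAt (ContinuousAt.mul
      (Real.continuousAt_rpow_const 0 _ (Or.inr ht0.le)) (ContinuousAt.inv₀ (by fun_prop) ?_))
    simpa using hx.ne'
  have h := integral_Ioi_of_hasDerivAt_of_tendsto hcw hder
    ((hint.const_mul _).add (hsq.const_mul _)) hlim
  rw [integral_add (hint.const_mul _) (hsq.const_mul _), integral_const_mul, integral_const_mul,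
    Real.zero_rpow ht0.ne', zero_mul, sub_zero] at h
  have h2 : x ^ (t - 2) * x = x ^ (t - 1) := by
    rw [← Real.rpow_add_one hx.ne']; ring_nf
  have h3 : x * (c * ∫ l in Ioi (0 : ℝ), l ^ (t - 1) * ((l + x)⁻¹) ^ 2) =
      x * ((1 - t) * x ^ (t - 2)) := by
    linear_combination c * h + (1 - t) * hc - (1 - t) * h2
  exact mul_left_cancel₀ hx.ne' h3

-- Factoring `l d + a = d (l + a/d)` reduces to `d = 1`. For `d = b^(-(1-t)/t)` the factor `d^(-t)`
-- becomes `b^(1-t)`, which is how `k₁` and `k₂` arise.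
open MeasureTheory Set in
theorem integral_scaled_resolvent_sq {t c d a : ℝ} (ht0 : 0 < t) (ht1 : t < 1) (hd : 0 < d)
    (ha : 0 < a)
    (hc : ∀ x : ℝ, 0 < x → IntegrableOn (fun l : ℝ => l ^ (t - 1) * (l + x)⁻¹) (Ioi 0) ∧
      c * ∫ l in Ioi (0 : ℝ), l ^ (t - 1) * (l + x)⁻¹ = x ^ (t - 1)) :
    IntegrableOn (fun l : ℝ => l ^ (t - 1) * ((l * d + a)⁻¹) ^ 2) (Ioi 0) ∧
      c * ∫ l in Ioi (0 : ℝ), l ^ (t - 1) * ((l * d + a)⁻¹) ^ 2 =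
        (1 - t) * (d ^ (-t) * a ^ (t - 2)) := by
  have hx : 0 < a / d := div_pos ha hd
  obtain ⟨h1, h2⟩ := integral_resolvent_sq ht0 ht1 hx (hc _ hx).1 (hc _ hx).2
  have heq : (fun l : ℝ => l ^ (t - 1) * ((l * d + a)⁻¹) ^ 2) =
      fun l => (d⁻¹) ^ 2 * (l ^ (t - 1) * ((l + a / d)⁻¹) ^ 2) := by
    funext l
    rw [show l * d + a = d * (l + a / d) by field_simp, mul_inv]
    ring
  rw [heq]
  refine ⟨h1.const_mul _, ?_⟩
  rw [integral_const_mul, mul_left_comm, h2, Real.div_rpow ha.le hd.le, Real.rpow_neg hd.le,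
    Real.rpow_sub hd, Real.rpow_two]
  have := Real.rpow_pos_of_pos hd t
  field_simp

/-! ### Trace bounds for products of inverses. -/

section ResolventBounds

variable {ι : Type*} [Fintype ι]

theorem re_trace_mul_le (M N : Matrix ι ι ℂ) :
    (Matrix.trace (star M * N)).re ≤
      ((Matrix.trace (star M * M)).re + (Matrix.trace (star N * N)).re) / 2 := by
  have h : 0 ≤ (Matrix.trace (star (M - N) * (M - N))).re :=
    (Complex.le_def.1 (Matrix.posSemidef_conjTranspose_mul_self (M - N)).trace_nonneg).1
  have h2 : (Matrix.trace (star N * M)).re = (Matrix.trace (star M * N)).re := by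
    have : Matrix.trace (star N * M) = star (Matrix.trace (star M * N)) := by
      rw [← Matrix.trace_conjTranspose, Matrix.conjTranspose_mul]
      simp [Matrix.star_eq_conjTranspose]
    rw [this]; simp
  simp only [star_sub, sub_mul, mul_sub, Matrix.trace_sub, Complex.sub_re, h2] at h
  linarith

variable [DecidableEq ι]

theorem trace_mul_nonneg {P Q : Matrix ι ι ℂ} (hP : P.PosSemidef) (hQ : Q.PosSemidef) :
    0 ≤ (Matrix.trace (P * Q)).re := by
  obtain ⟨S, rfl⟩ := CStarAlgebra.nonneg_iff_eq_star_mul_self.1 (Matrix.nonneg_iff_posSemidef.2 hQ)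
  rw [← mul_assoc, Matrix.trace_mul_comm, ← mul_assoc]
  exact (Complex.le_def.1 (hP.mul_mul_conjTranspose_same S).trace_nonneg).1

theorem trace_mul_le_trace_mul {P Q R : Matrix ι ι ℂ} (h : P ≤ Q) (hR : R.PosSemidef) :
    (Matrix.trace (P * R)).re ≤ (Matrix.trace (Q * R)).re := by
  have := trace_mul_nonneg (Matrix.le_iff.1 h) hR
  rw [sub_mul, Matrix.trace_sub, Complex.sub_re] at this
  linarith

/-- If `L ≥ u > 0` then `‖L⁻¹ H‖₂ ≤ u⁻¹ ‖H‖₂`. -/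
theorem trace_inv_mul_sq_le {L : Matrix ι ι ℂ} (hL : L.PosDef) {u : ℝ} (hu : 0 < u)
    (h : u • (1 : Matrix ι ι ℂ) ≤ L) (H : Matrix ι ι ℂ) :
    (Matrix.trace (star (L⁻¹ * H) * (L⁻¹ * H))).re ≤
      (u⁻¹) ^ 2 * (Matrix.trace (star H * H)).re := by
  set N := L⁻¹ * H with hN
  have hLN : L * N = H := by
    rw [hN, ← mul_assoc, Matrix.mul_nonsing_inv L ((Matrix.isUnit_iff_isUnit_det _).1 hL.isUnit),
      one_mul]
  have hLs : star L = L := hL.isHermitian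
  set E := L - u • (1 : Matrix ι ι ℂ) with hE
  have hEp : E.PosSemidef := Matrix.le_iff.1 h
  have hEs : star E = E := hEp.isHermitian
  have h1 : 0 ≤ (Matrix.trace (star N * E * N)).re :=
    (Complex.le_def.1 (hEp.conjTranspose_mul_mul_same N).trace_nonneg).1
  have h2 : 0 ≤ (Matrix.trace (star (E * N) * (E * N))).re :=
    (Complex.le_def.1 (Matrix.posSemidef_conjTranspose_mul_self (E * N)).trace_nonneg).1
  -- With `H = E N + u N` and `E ≥ 0`, the first two terms of this expansion have nonnegative trace.
  have hH : star H * H = star (E * N) * (E * N) + (2 * u) • (star N * E * N) +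
      (u ^ 2) • (star N * N) := by
    have : H = E * N + u • N := by rw [hE, sub_mul, hLN]; simp
    rw [this]
    simp only [star_add, star_mul, hEs, star_smul, star_trivial, add_mul, mul_add, smul_mul_assoc,
      mul_smul_comm, mul_assoc]
    module
  have h3 := congrArg (fun Z => (Matrix.trace Z).re) hH
  simp only [Matrix.trace_add, Matrix.trace_smul, Complex.add_re, Complex.smul_re, smul_eq_mul] at h3
  rw [inv_pow, ← div_eq_inv_mul, le_div_iff₀ (by positivity), h3]
  nlinarith [mul_nonneg hu.le h1]

/-- Cyclicity moves `K⁻¹` next to `Z`, so that the two inverses are estimated separately. -/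
theorem trace_resolvent_upper {L K Z H : Matrix ι ι ℂ} (hL : L.PosDef) (hK : K.PosDef) {u : ℝ}
    (hu : 0 < u) (hLu : u • (1 : Matrix ι ι ℂ) ≤ L) (hKu : u • (1 : Matrix ι ι ℂ) ≤ K)
    (hZ : Z.IsHermitian) (hH : H.IsHermitian) :
    (Matrix.trace (Z * (L⁻¹ * H * K⁻¹))).re ≤
      (u⁻¹) ^ 2 * (((Matrix.trace (Z * Z)).re + (Matrix.trace (H * H)).re) / 2) := by
  have hZs : star Z = Z := hZ
  have hHs : star H = H := hH
  have hKs : star K⁻¹ = K⁻¹ := hK.inv.isHermitian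
  have h : Matrix.trace (Z * (L⁻¹ * H * K⁻¹)) = Matrix.trace (star (Z * K⁻¹) * (L⁻¹ * H)) := by
    rw [star_mul, hKs, hZs, ← mul_assoc, Matrix.trace_mul_comm]
    simp only [mul_assoc]
  have h1 := trace_inv_mul_sq_le hL hu hLu H
  have h2 := trace_inv_mul_sq_le hK hu hKu Z
  have h3 : Matrix.trace (star (Z * K⁻¹) * (Z * K⁻¹)) =
      Matrix.trace (star (K⁻¹ * Z) * (K⁻¹ * Z)) := by
    simp only [star_mul, hKs, hZs]
    rw [Matrix.trace_mul_comm (Z * K⁻¹)]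
  rw [hHs] at h1
  rw [hZs] at h2
  have h4 := re_trace_mul_le (Z * K⁻¹) (L⁻¹ * H)
  rw [h3] at h4
  rw [h]
  linarith

theorem inv_lower {L : Matrix ι ι ℂ} (hL : L.PosDef) {u : ℝ} (hu : 0 < u)
    (h : L ≤ u • (1 : Matrix ι ι ℂ)) : u⁻¹ • (1 : Matrix ι ι ℂ) ≤ L⁻¹ := by
  have hu1 : L * L⁻¹ = 1 := Matrix.mul_nonsing_inv L ((Matrix.isUnit_iff_isUnit_det _).1 hL.isUnit)
  have hu2 : L⁻¹ * L = 1 := Matrix.nonsing_inv_mul L ((Matrix.isUnit_iff_isUnit_det _).1 hL.isUnit)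
  have hs : (L⁻¹ - u⁻¹ • (1 : Matrix ι ι ℂ)).IsHermitian :=
    hL.inv.isHermitian.sub (by simp [Matrix.IsHermitian])
  have h1 := hL.posSemidef.mul_mul_conjTranspose_same (L⁻¹ - u⁻¹ • (1 : Matrix ι ι ℂ))
  rw [hs.eq] at h1
  have h2 := (Matrix.le_iff.1 h).smul (show 0 ≤ (u⁻¹) ^ 2 by positivity)
  rw [Matrix.le_iff]
  -- A sum of two positive semidefinite terms, so commutation arguments are not needed.
  have e : L⁻¹ - u⁻¹ • (1 : Matrix ι ι ℂ) = (L⁻¹ - u⁻¹ • 1) * L * (L⁻¹ - u⁻¹ • 1) +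
      u⁻¹ ^ 2 • (u • 1 - L) := by
    simp only [sub_mul, mul_sub, smul_mul_assoc, mul_smul_comm, one_mul, mul_one, hu2, hu1,
    smul_sub, smul_smul]
    rw [show u⁻¹ ^ 2 * u = u⁻¹ by field_simp]
    module
  rw [e]
  exact h1.add h2

/-- First `S` is replaced by `r` against `H R H ≥ 0`, then `R` by `r` against `H² ≥ 0`. -/
theorem trace_resolvent_lower {R S H : Matrix ι ι ℂ} (hR : R.PosDef) {r : ℝ} (hr : 0 ≤ r)
    (hRr : r • (1 : Matrix ι ι ℂ) ≤ R) (hSr : r • (1 : Matrix ι ι ℂ) ≤ S)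
    (hH : H.IsHermitian) :
    r ^ 2 * (Matrix.trace (H * H)).re ≤ (Matrix.trace (H * (R * H * S))).re := by
  have hHs : Matrix.conjTranspose H = H := hH
  have h1 : (H * R * H).PosSemidef := by
    have := hR.posSemidef.mul_mul_conjTranspose_same H
    rwa [hHs] at this
  have h2 : (H * H).PosSemidef := by
    have := Matrix.posSemidef_conjTranspose_mul_self H
    rwa [hHs] at this
  have e1 : Matrix.trace (H * (R * H * S)) = Matrix.trace (S * (H * R * H)) := by
    rw [Matrix.trace_mul_comm S]; simp only [mul_assoc]
  have e2 : Matrix.trace (r • (1 : Matrix ι ι ℂ) * (H * R * H)) =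
      r • Matrix.trace (R * (H * H)) := by
    rw [smul_mul_assoc, one_mul, Matrix.trace_smul, mul_assoc, Matrix.trace_mul_comm H, mul_assoc]
  have i1 := trace_mul_le_trace_mul hSr h1
  have i2 := trace_mul_le_trace_mul hRr h2
  rw [e2, Complex.smul_re, smul_eq_mul] at i1
  rw [smul_mul_assoc, one_mul, Matrix.trace_smul, Complex.smul_re, smul_eq_mul] at i2
  rw [e1]
  nlinarith [mul_le_mul_of_nonneg_left i2 hr]

end ResolventBounds

/-! ### Scalar Loewner bounds read off the spectrum. -/

section LoewnerBounds

variable {ι : Type*} [Fintype ι] [DecidableEq ι]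

theorem smul_one_le_iff {P : Matrix ι ι ℂ} (hP : P.IsHermitian) {a : ℝ} :
    a • (1 : Matrix ι ι ℂ) ≤ P ↔ ∀ x ∈ spectrum ℝ P, a ≤ x := by
  have hPs : IsSelfAdjoint P := hP
  rw [← Algebra.algebraMap_eq_smul_one, algebraMap_le_iff_le_spectrum (a := P)]

theorem le_smul_one_iff {P : Matrix ι ι ℂ} (hP : P.IsHermitian) {a : ℝ} :
    P ≤ a • (1 : Matrix ι ι ℂ) ↔ ∀ x ∈ spectrum ℝ P, x ≤ a := by
  have hPs : IsSelfAdjoint P := hP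
  rw [← Algebra.algebraMap_eq_smul_one, le_algebraMap_iff_spectrum_le (a := P)]

theorem smul_one_le_rpow {P : Matrix ι ι ℂ} (hP : P.PosDef) {a s : ℝ}
    (h : ∀ x ∈ spectrum ℝ P, a ≤ x ^ s) : a • (1 : Matrix ι ι ℂ) ≤ P ^ s := by
  have hPs : IsSelfAdjoint P := hP.isHermitian
  rw [← Algebra.algebraMap_eq_smul_one, rpow_eq_cfc hP.posSemidef]
  exact algebraMap_le_cfc _ _ P h (continuousOn_spectrum _ hPs) hPs

theorem rpow_le_smul_one {P : Matrix ι ι ℂ} (hP : P.PosDef) {a s : ℝ}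
    (h : ∀ x ∈ spectrum ℝ P, x ^ s ≤ a) : P ^ s ≤ a • (1 : Matrix ι ι ℂ) := by
  have hPs : IsSelfAdjoint P := hP.isHermitian
  rw [← Algebra.algebraMap_eq_smul_one, rpow_eq_cfc hP.posSemidef]
  exact cfc_le_algebraMap _ _ P h (continuousOn_spectrum _ hPs) hPs

theorem posDef_of_smul_one_le {P : Matrix ι ι ℂ} (hP : P.IsHermitian) {a : ℝ} (ha : 0 < a)
    (h : a • (1 : Matrix ι ι ℂ) ≤ P) : P.PosDef := by
  refine hP.posDef_iff_eigenvalues_pos.2 fun i => ha.trans_le ((smul_one_le_iff hP).1 h _ ?_)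
  rw [hP.spectrum_real_eq_range_eigenvalues]
  exact ⟨i, rfl⟩

theorem conj_le_conj {P Q : Matrix ι ι ℂ} (h : P ≤ Q) {S : Matrix ι ι ℂ} (hS : S.IsHermitian) :
    S * P * S ≤ S * Q * S := by
  have := (Matrix.le_iff.1 h).mul_mul_conjTranspose_same S
  rw [hS.eq] at this
  rw [Matrix.le_iff]
  convert this using 1
  noncomm_ring

end LoewnerBounds

/-! ### The gradient of the fidelity and its resolvent integral. -/

section FidelityGradient

variable {n : ℕ}

theorem mul_mul_isHermitian {ι : Type*} [Fintype ι] {B S : Matrix ι ι ℂ} (hB : B.IsHermitian)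
    (hS : S.IsHermitian) : (B * S * B).IsHermitian := by
  have := Matrix.isHermitian_mul_mul_conjTranspose B hS
  rwa [hB.eq] at this

/-- The gradient `t A^s (A^s X A^s)^(t-1) A^s` of `X ↦ F_t(A, X)`, where `s = (1-t)/2t`. -/
def fidelityGrad (t : ℝ) (A X : Herm n) : Herm n :=
  t • Herm.ofMat (Herm.toMat A ^ ((1 - t) / (2 * t)) * (Herm.toMat A ^ ((1 - t) / (2 * t)) *
    Herm.toMat X * Herm.toMat A ^ ((1 - t) / (2 * t))) ^ (t - 1) *
      Herm.toMat A ^ ((1 - t) / (2 * t)))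
    (mul_mul_isHermitian (rpow_isHermitian _ _) (rpow_isHermitian _ _))

theorem inner_fidelityGrad (t : ℝ) (A X Z : Herm n) :
    inner ℝ (fidelityGrad t A X) Z =
      t * (Matrix.trace ((Herm.toMat A ^ ((1 - t) / (2 * t)) * Herm.toMat X *
        Herm.toMat A ^ ((1 - t) / (2 * t))) ^ (t - 1) * (Herm.toMat A ^ ((1 - t) / (2 * t)) *
          Herm.toMat Z * Herm.toMat A ^ ((1 - t) / (2 * t))))).re := by
  rw [fidelityGrad, real_inner_smul_left, Herm.inner_def, Herm.toMat_ofMat, mul_assoc, mul_assoc,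
    Matrix.trace_mul_comm]
  simp only [mul_assoc]

theorem fidelity_le_tangent {t : ℝ} (ht0 : 0 < t) (ht1 : t < 1) {A X Y : Herm n}
    (hA : A ∈ Pos n) (hX : X ∈ Pos n) (hY : Y ∈ Pos n) :
    fidelity t A Y ≤ fidelity t A X + inner ℝ (fidelityGrad t A X) (Y - X) := by
  have hB := rpow_posDef hA ((1 - t) / (2 * t))
  have h := trace_rpow_le_tangent (posDef_mul_mul hB hX) (posDef_mul_mul hB hY) ht0.le ht1.le
  rw [inner_fidelityGrad, map_sub, mul_sub, sub_mul]
  exact h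

/-- The matrix power is never differentiated: by the tangent bound, `X` is a local minimum of the
tangent minus the fidelity, so the derivative of that difference vanishes. -/
theorem hasGradientAt_fidelity {t : ℝ} (ht0 : 0 < t) (ht1 : t < 1) {A X : Herm n}
    (hA : A ∈ Pos n) (hX : X ∈ Pos n) :
    HasGradientAt (fidelity t A) (fidelityGrad t A X) X := by
  have hd : DifferentiableAt ℝ (fidelity t A) X :=
    (contDiffAt_fidelity hA hX t).differentiableAt (by simp)
  have hmin : IsLocalMin (fun Y => inner ℝ (fidelityGrad t A X) Y - fidelity t A Y) X := by
    filter_upwards [pos_isOpen.mem_nhds hX] with Y hY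
    have := fidelity_le_tangent ht0 ht1 hA hX hY
    rw [inner_sub_right] at this
    linarith
  have hder := ((innerSL ℝ (fidelityGrad t A X)).hasFDerivAt (x := X)).sub hd.hasFDerivAt
  have h0 := hmin.hasFDerivAt_eq_zero hder
  have he : InnerProductSpace.toDual ℝ (Herm n) (fidelityGrad t A X) =
      fderiv ℝ (fidelity t A) X := sub_eq_zero.1 h0
  rw [hasGradientAt_iff_hasFDerivAt, he]
  exact hd.hasFDerivAt

/-- Here `D` stands for `B⁻²`. Absorbing the outer factors leaves `X` as a bare summand, so that
resolvents at two points differ in a simple way. -/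
theorem sandwich_resolvent {B D X : Matrix (Fin n) (Fin n) ℂ} (hBDB : B * D * B = 1)
    (hB : B.PosDef) (l : ℝ) :
    B * (l • 1 + B * X * B)⁻¹ * B = (l • D + X)⁻¹ := by
  have h : l • 1 + B * X * B = B * (l • D + X) * B := by
    rw [mul_add, add_mul, mul_smul_comm, smul_mul_assoc, hBDB]
  have hBu := (Matrix.isUnit_iff_isUnit_det _).1 hB.isUnit
  rw [h, Matrix.mul_inv_rev, Matrix.mul_inv_rev, ← mul_assoc, ← mul_assoc,
    Matrix.mul_nonsing_inv B hBu, one_mul, mul_assoc, Matrix.nonsing_inv_mul B hBu, mul_one]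

theorem conj_rpow_eq_one {A : Herm n} (hA : A ∈ Pos n) (t : ℝ) :
    Herm.toMat A ^ ((1 - t) / (2 * t)) * Herm.toMat A ^ (-((1 - t) / t)) *
      Herm.toMat A ^ ((1 - t) / (2 * t)) = 1 := by
  have hu : IsUnit (Herm.toMat A) := Matrix.PosDef.isUnit hA
  have h0 : 0 ≤ Herm.toMat A := (Matrix.PosDef.isStrictlyPositive hA).nonneg
  rw [← CFC.rpow_add hu, ← CFC.rpow_add hu, ← CFC.rpow_zero _ h0]
  congr 1
  ring

-- Pairing with `Z` and diagonalising `B X B` reduces everything to finitely many scalar integrals;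
-- no matrix-valued integral is needed.
open MeasureTheory Set in
theorem inner_fidelityGrad_eq_integral {t c : ℝ}
    (hc : ∀ x : ℝ, 0 < x → IntegrableOn (fun l : ℝ => l ^ (t - 1) * (l + x)⁻¹) (Ioi 0) ∧
      c * ∫ l in Ioi (0 : ℝ), l ^ (t - 1) * (l + x)⁻¹ = x ^ (t - 1))
    {A X : Herm n} (hA : A ∈ Pos n) (hX : X ∈ Pos n) (Z : Herm n) :
    IntegrableOn (fun l : ℝ => l ^ (t - 1) * (Matrix.trace (Herm.toMat Z *
      (l • Herm.toMat A ^ (-((1 - t) / t)) + Herm.toMat X)⁻¹)).re) (Ioi 0) ∧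
    inner ℝ (fidelityGrad t A X) Z = t * (c * ∫ l in Ioi (0 : ℝ), l ^ (t - 1) *
      (Matrix.trace (Herm.toMat Z *
        (l • Herm.toMat A ^ (-((1 - t) / t)) + Herm.toMat X)⁻¹)).re) := by
  rw [inner_fidelityGrad]
  have hone := conj_rpow_eq_one hA t
  have hB := rpow_posDef hA ((1 - t) / (2 * t))
  set B := Herm.toMat A ^ ((1 - t) / (2 * t))
  have hP := posDef_mul_mul hB hX
  obtain ⟨q, hq⟩ := exists_trace_mul_cfc (B * Herm.toMat Z * B) hP.isHermitian
  have heq : ∀ l ∈ Ioi (0 : ℝ), ∑ i, l ^ (t - 1) * (l + hP.isHermitian.eigenvalues i)⁻¹ * q i =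
      l ^ (t - 1) * (Matrix.trace (Herm.toMat Z *
        (l • Herm.toMat A ^ (-((1 - t) / t)) + Herm.toMat X)⁻¹)).re := by
    intro l hl
    have h := hq (fun x => (l + x)⁻¹)
    rw [← resolvent_eq_cfc hP hl] at h
    have h2 : Matrix.trace (B * Herm.toMat Z * B * (l • 1 + B * Herm.toMat X * B)⁻¹) =
        Matrix.trace (Herm.toMat Z * (B * (l • 1 + B * Herm.toMat X * B)⁻¹ * B)) := by
      generalize (l • 1 + B * Herm.toMat X * B)⁻¹ = R
      rw [show B * Herm.toMat Z * B * R = B * (Herm.toMat Z * B * R) by simp only [mul_assoc],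
        Matrix.trace_mul_comm]
      simp only [mul_assoc]
    rw [← sandwich_resolvent hone hB l, ← h2, h, Finset.mul_sum]
    exact Finset.sum_congr rfl fun i _ => mul_assoc _ _ _
  have hi : ∀ i ∈ Finset.univ, Integrable (fun l : ℝ => l ^ (t - 1) *
      (l + hP.isHermitian.eigenvalues i)⁻¹ * q i) (volume.restrict (Ioi 0)) := fun i _ =>
    ((hc _ (hP.eigenvalues_pos i)).1).mul_const _
  refine ⟨IntegrableOn.congr_fun (integrable_finsetSum _ hi) heq measurableSet_Ioi, ?_⟩
  rw [← setIntegral_congr_fun measurableSet_Ioi heq, integral_finsetSum _ hi, Finset.mul_sum,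
    Matrix.trace_mul_comm, rpow_eq_cfc hP.posSemidef, hq]
  congr 1
  refine Finset.sum_congr rfl fun i _ => ?_
  rw [integral_mul_const, ← mul_assoc, (hc _ (hP.eigenvalues_pos i)).2]

end FidelityGradient

/-! ### Two-sided bounds for differences of fidelity gradients. -/

section ResolventIntegrals

variable {n : ℕ}

theorem Herm.norm_sq_eq (Z : Herm n) :
    ‖Z‖ ^ 2 = (Matrix.trace (Herm.toMat Z * Herm.toMat Z)).re := by
  rw [← real_inner_self_eq_norm_sq, Herm.inner_def]

theorem loewnerIcc_subset_pos {α β : ℝ} (hα : 0 < α) : loewnerIcc n α β ⊆ Pos n :=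
  fun X hX => posDef_of_smul_one_le X.isHermitian hα hX.1

theorem inv_sub_inv_eq {ι : Type*} [Fintype ι] [DecidableEq ι] {L K : Matrix ι ι ℂ}
    (hL : L.PosDef) (hK : K.PosDef) : L⁻¹ - K⁻¹ = L⁻¹ * (K - L) * K⁻¹ := by
  rw [mul_sub, sub_mul, mul_assoc,
    Matrix.mul_nonsing_inv K ((Matrix.isUnit_iff_isUnit_det _).1 hK.isUnit),
    Matrix.nonsing_inv_mul L ((Matrix.isUnit_iff_isUnit_det _).1 hL.isUnit), mul_one, one_mul]

/-- The exponent `-(1-t)/t` is nonpositive and reverses order, which is why `β` enters the lower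
bound and `α` the upper one. -/
theorem resolvent_bounds {t α β : ℝ} (ht0 : 0 < t) (ht1 : t < 1) (hα : 0 < α)
    {A X : Herm n} (hA : A ∈ loewnerIcc n α β) (hX : X ∈ loewnerIcc n α β) {l : ℝ} (hl : 0 < l) :
    (l * β ^ (-((1 - t) / t)) + α) • (1 : Matrix (Fin n) (Fin n) ℂ) ≤
        l • Herm.toMat A ^ (-((1 - t) / t)) + Herm.toMat X ∧
      l • Herm.toMat A ^ (-((1 - t) / t)) + Herm.toMat X ≤
        (l * α ^ (-((1 - t) / t)) + β) • (1 : Matrix (Fin n) (Fin n) ℂ) := by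
  have hAp : (Herm.toMat A).PosDef := loewnerIcc_subset_pos hα hA
  have hr : -((1 - t) / t) ≤ 0 := by
    have : 0 ≤ (1 - t) / t := div_nonneg (by linarith) ht0.le
    linarith
  have h1 := (smul_one_le_iff A.isHermitian).1 hA.1
  have h2 := (le_smul_one_iff A.isHermitian).1 hA.2
  have hlow : β ^ (-((1 - t) / t)) • (1 : Matrix (Fin n) (Fin n) ℂ) ≤
      Herm.toMat A ^ (-((1 - t) / t)) := smul_one_le_rpow hAp fun x hx =>
    Real.rpow_le_rpow_of_nonpos (mem_spectrum_pos hAp hx) (h2 x hx) hr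
  have hupp : Herm.toMat A ^ (-((1 - t) / t)) ≤
      α ^ (-((1 - t) / t)) • (1 : Matrix (Fin n) (Fin n) ℂ) := rpow_le_smul_one hAp fun x hx =>
    Real.rpow_le_rpow_of_nonpos hα (h1 x hx) hr
  rw [add_smul, add_smul, mul_smul, mul_smul]
  refine ⟨add_le_add ?_ hX.1, add_le_add ?_ hX.2⟩
  · have := (Matrix.le_iff.1 hlow).smul hl.le
    rw [Matrix.le_iff, ← smul_sub]
    exact this
  · have := (Matrix.le_iff.1 hupp).smul hl.le
    rw [Matrix.le_iff, ← smul_sub]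
    exact this

theorem resolvent_posDef {A X : Herm n} (hA : A ∈ Pos n) (hX : X ∈ Pos n) (s : ℝ) {l : ℝ}
    (hl : 0 < l) : (l • Herm.toMat A ^ s + Herm.toMat X).PosDef :=
  Matrix.PosDef.add ((rpow_posDef hA s).smul hl) hX

theorem resolvent_diff {A X Y : Herm n} (hA : A ∈ Pos n) (hX : X ∈ Pos n) (hY : Y ∈ Pos n) (s : ℝ)
    {l : ℝ} (hl : 0 < l) :
    (l • Herm.toMat A ^ s + Herm.toMat X)⁻¹ - (l • Herm.toMat A ^ s + Herm.toMat Y)⁻¹ =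
      (l • Herm.toMat A ^ s + Herm.toMat X)⁻¹ * Herm.toMat (Y - X) *
        (l • Herm.toMat A ^ s + Herm.toMat Y)⁻¹ := by
  rw [inv_sub_inv_eq (resolvent_posDef hA hX s hl) (resolvent_posDef hA hY s hl), map_sub,
    add_sub_add_left_eq_sub]

theorem rpow_neg_div_rpow_neg {t b : ℝ} (ht0 : 0 < t) (hb : 0 < b) :
    (b ^ (-((1 - t) / t))) ^ (-t) = b ^ (1 - t) := by
  rw [← Real.rpow_mul hb.le]
  congr 1
  field_simp

open MeasureTheory Set in
theorem inner_fidelityGrad_sub_eq_integral {t c : ℝ}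
    (hc : ∀ x : ℝ, 0 < x → IntegrableOn (fun l : ℝ => l ^ (t - 1) * (l + x)⁻¹) (Ioi 0) ∧
      c * ∫ l in Ioi (0 : ℝ), l ^ (t - 1) * (l + x)⁻¹ = x ^ (t - 1))
    {A X Y : Herm n} (hA : A ∈ Pos n) (hX : X ∈ Pos n) (hY : Y ∈ Pos n) (Z : Herm n) :
    IntegrableOn (fun l : ℝ => l ^ (t - 1) * (Matrix.trace (Herm.toMat Z *
      ((l • Herm.toMat A ^ (-((1 - t) / t)) + Herm.toMat X)⁻¹ * Herm.toMat (Y - X) *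
        (l • Herm.toMat A ^ (-((1 - t) / t)) + Herm.toMat Y)⁻¹))).re) (Ioi 0) ∧
    inner ℝ (fidelityGrad t A X - fidelityGrad t A Y) Z = t * (c * ∫ l in Ioi (0 : ℝ), l ^ (t - 1) *
      (Matrix.trace (Herm.toMat Z *
      ((l • Herm.toMat A ^ (-((1 - t) / t)) + Herm.toMat X)⁻¹ * Herm.toMat (Y - X) *
        (l • Herm.toMat A ^ (-((1 - t) / t)) + Herm.toMat Y)⁻¹))).re) := by
  obtain ⟨iX, eX⟩ := inner_fidelityGrad_eq_integral hc hA hX Z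
  obtain ⟨iY, eY⟩ := inner_fidelityGrad_eq_integral hc hA hY Z
  have heq : ∀ l ∈ Ioi (0 : ℝ), l ^ (t - 1) * (Matrix.trace (Herm.toMat Z *
      (l • Herm.toMat A ^ (-((1 - t) / t)) + Herm.toMat X)⁻¹)).re -
      l ^ (t - 1) * (Matrix.trace (Herm.toMat Z *
      (l • Herm.toMat A ^ (-((1 - t) / t)) + Herm.toMat Y)⁻¹)).re = l ^ (t - 1) *
      (Matrix.trace (Herm.toMat Z *
      ((l • Herm.toMat A ^ (-((1 - t) / t)) + Herm.toMat X)⁻¹ * Herm.toMat (Y - X) *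
        (l • Herm.toMat A ^ (-((1 - t) / t)) + Herm.toMat Y)⁻¹))).re := by
    intro l hl
    rw [← resolvent_diff hA hX hY _ hl, mul_sub, Matrix.trace_sub, Complex.sub_re, mul_sub]
  refine ⟨IntegrableOn.congr_fun (iX.sub iY) heq measurableSet_Ioi, ?_⟩
  rw [← setIntegral_congr_fun measurableSet_Ioi heq, integral_sub iX iY, inner_sub_left, eX, eY]
  ring

-- The test direction `Z` is free, so this quadratic bound yields a Lipschitz estimate through
-- `norm_le_of_inner_le`.
open MeasureTheory Set in
theorem inner_fidelityGrad_sub_le {t α β : ℝ} (ht0 : 0 < t) (ht1 : t < 1) (hα : 0 < α)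
    (hβ : 0 < β) {A X Y : Herm n} (hA : A ∈ loewnerIcc n α β) (hX : X ∈ loewnerIcc n α β)
    (hY : Y ∈ loewnerIcc n α β) (Z : Herm n) :
    inner ℝ (fidelityGrad t A X - fidelityGrad t A Y) Z ≤
      t * (1 - t) * β ^ (1 - t) * α ^ (t - 2) * ((‖Z‖ ^ 2 + ‖X - Y‖ ^ 2) / 2) := by
  obtain ⟨c, hc0, hc⟩ := exists_resolvent_representation ht0 ht1
  have hAp := loewnerIcc_subset_pos hα hA
  have hXp := loewnerIcc_subset_pos hα hX
  have hYp := loewnerIcc_subset_pos hα hY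
  have hd : 0 < β ^ (-((1 - t) / t)) := Real.rpow_pos_of_pos hβ _
  obtain ⟨i1, e1⟩ := inner_fidelityGrad_sub_eq_integral hc hAp hXp hYp Z
  obtain ⟨i2, e2⟩ := integral_scaled_resolvent_sq ht0 ht1 hd hα hc
  rw [rpow_neg_div_rpow_neg ht0 hβ] at e2
  have hle := setIntegral_mono_on i1 (i2.mul_const ((‖Z‖ ^ 2 + ‖X - Y‖ ^ 2) / 2))
    measurableSet_Ioi (fun l hl => by
      have hl : 0 < l := hl
      have h := trace_resolvent_upper (resolvent_posDef hAp hXp (-((1 - t) / t)) hl)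
        (resolvent_posDef hAp hYp (-((1 - t) / t)) hl) (by positivity)
        (resolvent_bounds ht0 ht1 hα hA hX hl).1 (resolvent_bounds ht0 ht1 hα hA hY hl).1
        Z.isHermitian (Y - X).isHermitian
      rw [← Herm.norm_sq_eq, ← Herm.norm_sq_eq, norm_sub_rev Y X] at h
      exact (mul_le_mul_of_nonneg_left h (Real.rpow_nonneg hl.le (t - 1))).trans_eq
        (mul_assoc _ _ _).symm)
  rw [integral_mul_const] at hle
  rw [e1]
  calc _ ≤ t * (c * ((∫ l in Ioi (0 : ℝ), l ^ (t - 1) *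
        ((l * β ^ (-((1 - t) / t)) + α)⁻¹) ^ 2) * ((‖Z‖ ^ 2 + ‖X - Y‖ ^ 2) / 2))) := by gcongr
    _ = t * ((c * ∫ l in Ioi (0 : ℝ), l ^ (t - 1) *
        ((l * β ^ (-((1 - t) / t)) + α)⁻¹) ^ 2) * ((‖Z‖ ^ 2 + ‖X - Y‖ ^ 2) / 2)) := by ring
    _ = _ := by rw [e2]; ring

open MeasureTheory Set in
theorem le_inner_fidelityGrad_sub {t α β : ℝ} (ht0 : 0 < t) (ht1 : t < 1) (hα : 0 < α)
    (hβ : 0 < β) {A X Y : Herm n} (hA : A ∈ loewnerIcc n α β) (hX : X ∈ loewnerIcc n α β)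
    (hY : Y ∈ loewnerIcc n α β) :
    t * (1 - t) * β ^ (t - 2) * α ^ (1 - t) * ‖X - Y‖ ^ 2 ≤
      inner ℝ (fidelityGrad t A X - fidelityGrad t A Y) (Y - X) := by
  obtain ⟨c, hc0, hc⟩ := exists_resolvent_representation ht0 ht1
  have hAp := loewnerIcc_subset_pos hα hA
  have hXp := loewnerIcc_subset_pos hα hX
  have hYp := loewnerIcc_subset_pos hα hY
  have hd : 0 < α ^ (-((1 - t) / t)) := Real.rpow_pos_of_pos hα _
  obtain ⟨i1, e1⟩ := inner_fidelityGrad_sub_eq_integral hc hAp hXp hYp (Y - X)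
  obtain ⟨i2, e2⟩ := integral_scaled_resolvent_sq ht0 ht1 hd hβ hc
  rw [rpow_neg_div_rpow_neg ht0 hα] at e2
  have hle := setIntegral_mono_on (i2.mul_const (‖X - Y‖ ^ 2)) i1
    measurableSet_Ioi (fun l hl => by
      have hl : 0 < l := hl
      have hL := resolvent_posDef hAp hXp (-((1 - t) / t)) hl
      have hK := resolvent_posDef hAp hYp (-((1 - t) / t)) hl
      have hu : 0 < l * α ^ (-((1 - t) / t)) + β := by positivity
      have h := trace_resolvent_lower hL.inv (inv_nonneg.2 hu.le)
        (inv_lower hL hu (resolvent_bounds ht0 ht1 hα hA hX hl).2)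
        (inv_lower hK hu (resolvent_bounds ht0 ht1 hα hA hY hl).2) (Y - X).isHermitian
      rw [← Herm.norm_sq_eq, norm_sub_rev Y X] at h
      rw [mul_assoc]
      exact mul_le_mul_of_nonneg_left h (by positivity))
  rw [integral_mul_const] at hle
  rw [e1]
  calc _ = t * ((c * ∫ l in Ioi (0 : ℝ), l ^ (t - 1) *
        ((l * α ^ (-((1 - t) / t)) + β)⁻¹) ^ 2) * ‖X - Y‖ ^ 2) := by rw [e2]; ring
    _ = t * (c * ((∫ l in Ioi (0 : ℝ), l ^ (t - 1) *
        ((l * α ^ (-((1 - t) / t)) + β)⁻¹) ^ 2) * ‖X - Y‖ ^ 2)) := by ring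
    _ ≤ _ := by gcongr

end ResolventIntegrals

/-! ### Gradient, smoothness and strong convexity of the objective. -/

section Objective

theorem bregman_ge_of_strongly_monotone {E : Type*} [NormedAddCommGroup E] [InnerProductSpace ℝ E]
    [CompleteSpace E] {f : E → ℝ} {g : E → E} {K : Set E} (hK : Convex ℝ K) {k : ℝ}
    (hg : ∀ X ∈ K, HasGradientAt f (g X) X)
    (hm : ∀ X ∈ K, ∀ Y ∈ K, k * ‖X - Y‖ ^ 2 ≤ inner ℝ (g X - g Y) (X - Y)) {X Y : E}
    (hX : X ∈ K) (hY : Y ∈ K) :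
    k / 2 * ‖X - Y‖ ^ 2 ≤ f Y - f X - inner ℝ (g X) (Y - X) := by
  set V := Y - X with hV
  have hmem : ∀ s ∈ Set.Icc (0 : ℝ) 1, X + s • V ∈ K := fun s hs =>
    hK.add_smul_sub_mem hX hY hs
  have hder : ∀ s ∈ Set.Icc (0 : ℝ) 1, HasDerivAt
      (fun s : ℝ => f (X + s • V) - s * inner ℝ (g X) V - k / 2 * s ^ 2 * ‖V‖ ^ 2)
      (inner ℝ (g (X + s • V)) V - inner ℝ (g X) V - k * s * ‖V‖ ^ 2) s := by
    intro s hs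
    have h1 : HasDerivAt (fun s : ℝ => X + s • V) V s := by
      simpa using ((hasDerivAt_id s).smul_const V).const_add X
    have h2 := (hg _ (hmem s hs)).hasFDerivAt.comp_hasDerivAt s h1
    have h3 := (h2.sub ((hasDerivAt_id s).mul_const (inner ℝ (g X) V))).sub
      ((((hasDerivAt_id s).pow 2).const_mul (k / 2)).mul_const (‖V‖ ^ 2))
    refine h3.congr_deriv ?_
    simp only [InnerProductSpace.toDual_apply_apply, id]
    ring
  have hmono : MonotoneOn
      (fun s : ℝ => f (X + s • V) - s * inner ℝ (g X) V - k / 2 * s ^ 2 * ‖V‖ ^ 2)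
      (Set.Icc 0 1) := by
    refine monotoneOn_of_deriv_nonneg (convex_Icc 0 1)
      (fun s hs => (hder s hs).continuousAt.continuousWithinAt)
      (fun s hs => (hder s (interior_subset hs)).differentiableAt.differentiableWithinAt)
      fun s hs => ?_
    rw [(hder s (interior_subset hs)).deriv]
    rw [interior_Icc] at hs
    -- Monotonicity between `X + s V` and `X` carries one superfluous factor `s`, which is positive
    -- in the interior and cancels.
    have h := hm _ (hmem s ⟨hs.1.le, hs.2.le⟩) X hX
    rw [add_sub_cancel_left, inner_smul_right, inner_sub_left, norm_smul, Real.norm_of_nonneg hs.1.le,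
      mul_pow] at h
    have hs0 := hs.1
    have : k * s * ‖V‖ ^ 2 ≤ inner ℝ (g (X + s • V)) V - inner ℝ (g X) V := by
      refine le_of_mul_le_mul_left ?_ hs0
      calc _ = k * (s ^ 2 * ‖V‖ ^ 2) := by ring
        _ ≤ _ := h
    linarith
  have h := hmono (Set.left_mem_Icc.2 zero_le_one) (Set.right_mem_Icc.2 zero_le_one) zero_le_one
  simp only [zero_smul, add_zero, one_smul, hV, add_sub_cancel] at h
  rw [norm_sub_rev X Y]
  simp only [hV]
  nlinarith

theorem norm_le_of_inner_le {E : Type*} [NormedAddCommGroup E] [InnerProductSpace ℝ E] {v : E}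
    {k a : ℝ} (hk : 0 < k) (ha : 0 ≤ a)
    (h : ∀ z : E, inner ℝ v z ≤ k * ((‖z‖ ^ 2 + a ^ 2) / 2)) : ‖v‖ ≤ k * a := by
  -- This choice of `z` leaves half of `‖v‖²` on the right, to be absorbed on the left.
  have h1 := h (k⁻¹ • v)
  rw [inner_smul_right, real_inner_self_eq_norm_sq, norm_smul, Real.norm_of_nonneg (by positivity),
    mul_pow] at h1
  have h2 : ‖v‖ ^ 2 ≤ (k * a) ^ 2 := by
    have h3 := mul_le_mul_of_nonneg_left h1 hk.le
    have e1 : k * (k⁻¹ * ‖v‖ ^ 2) = ‖v‖ ^ 2 := by field_simp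
    have e2 : k * (k * ((k⁻¹ ^ 2 * ‖v‖ ^ 2 + a ^ 2) / 2)) = (‖v‖ ^ 2 + (k * a) ^ 2) / 2 := by
      field_simp
    rw [e1, e2] at h3
    linarith
  exact le_of_sq_le_sq h2 (by positivity)

variable {n m : ℕ}

/-- The identity matrix, as a Hermitian matrix. -/
def Herm.one (n : ℕ) : Herm n := Herm.ofMat 1 Matrix.isHermitian_one

/-- The gradient of `phi`. -/
def phiGrad (w : Fin m → ℝ) (A : Fin m → Herm n) (t : ℝ) (X : Herm n) : Herm n :=
  ∑ j, w j • (t • Herm.one n - fidelityGrad t (A j) X)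

theorem phi_eq (w : Fin m → ℝ) (A : Fin m → Herm n) (t : ℝ) (X : Herm n) :
    phi w A t X = ∑ j, w j * ((1 - t) * (Matrix.trace (Herm.toMat (A j))).re +
      inner ℝ (t • Herm.one n) X - fidelity t (A j) X) := by
  simp [phi, Herm.inner_def, Herm.one, real_inner_smul_left]

theorem contDiffAt_phi (w : Fin m → ℝ) {A : Fin m → Herm n} (hA : ∀ j, A j ∈ Pos n) (t : ℝ)
    {X : Herm n} (hX : X ∈ Pos n) : ContDiffAt ℝ ∞ (phi w A t) X := by
  rw [show phi w A t = _ from funext (phi_eq w A t)]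
  refine ContDiffAt.sum fun j _ => contDiffAt_const.mul ?_
  refine ContDiffAt.sub (contDiffAt_const.add ?_) (contDiffAt_fidelity (hA j) hX t)
  exact (innerSL ℝ (t • Herm.one n)).contDiff.contDiffAt

theorem hasGradientAt_phi {t : ℝ} (ht0 : 0 < t) (ht1 : t < 1) (w : Fin m → ℝ)
    {A : Fin m → Herm n} (hA : ∀ j, A j ∈ Pos n) {X : Herm n} (hX : X ∈ Pos n) :
    HasGradientAt (phi w A t) (phiGrad w A t X) X := by
  rw [show phi w A t = _ from funext (phi_eq w A t), hasGradientAt_iff_hasFDerivAt]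
  have h : ∀ j ∈ Finset.univ, HasFDerivAt (fun X : Herm n => w j * ((1 - t) *
      (Matrix.trace (Herm.toMat (A j))).re + inner ℝ (t • Herm.one n) X - fidelity t (A j) X))
      (w j • (innerSL ℝ (t • Herm.one n) -
        InnerProductSpace.toDual ℝ _ (fidelityGrad t (A j) X))) X := fun j _ =>
    ((((innerSL ℝ (t • Herm.one n)).hasFDerivAt (x := X)).const_add _).sub
      (hasGradientAt_fidelity ht0 ht1 (hA j) hX).hasFDerivAt).const_mul (w j)
  refine (HasFDerivAt.fun_sum h).congr_fderiv ?_
  ext Z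
  simp [phiGrad]

theorem phi_ge_tangent {t : ℝ} (ht0 : 0 < t) (ht1 : t < 1) {w : Fin m → ℝ} (hw : ∀ j, 0 ≤ w j)
    {A : Fin m → Herm n} (hA : ∀ j, A j ∈ Pos n) {X Y : Herm n} (hX : X ∈ Pos n) (hY : Y ∈ Pos n) :
    phi w A t X + inner ℝ (phiGrad w A t X) (Y - X) ≤ phi w A t Y := by
  rw [phi_eq, phi_eq, phiGrad, sum_inner, ← Finset.sum_add_distrib]
  refine Finset.sum_le_sum fun j _ => ?_
  rw [real_inner_smul_left (_ - _) _ (w j), ← mul_add]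
  refine mul_le_mul_of_nonneg_left ?_ (hw j)
  have h := fidelity_le_tangent ht0 ht1 (hA j) hX hY
  rw [inner_sub_left, inner_sub_right (t • Herm.one n)]
  linarith

theorem phiGrad_sub {t : ℝ} (w : Fin m → ℝ) (A : Fin m → Herm n) (X Y : Herm n) :
    phiGrad w A t X - phiGrad w A t Y =
      ∑ j, w j • (fidelityGrad t (A j) Y - fidelityGrad t (A j) X) := by
  rw [phiGrad, phiGrad, ← Finset.sum_sub_distrib]
  refine Finset.sum_congr rfl fun j _ => ?_
  rw [← smul_sub, sub_sub_sub_cancel_left]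

theorem convex_loewnerIcc (α β : ℝ) : Convex ℝ (loewnerIcc n α β) := by
  have : loewnerIcc n α β = Herm.toMat ⁻¹' (Set.Icc (α • 1) (β • 1)) := rfl
  rw [this]
  exact (convex_Icc _ _).linear_preimage _

section LoewnerInterval

variable {t : ℝ} {w : Fin m → ℝ} {A : Fin m → Herm n} {α β : ℝ} {X Y : Herm n}

theorem norm_phiGrad_sub_le (ht0 : 0 < t) (ht1 : t < 1) (hw : ∀ j, 0 ≤ w j) (hw1 : ∑ j, w j = 1)
    (hα : 0 < α) (hβ : 0 < β) (hA : ∀ j, A j ∈ loewnerIcc n α β)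
    (hX : X ∈ loewnerIcc n α β) (hY : Y ∈ loewnerIcc n α β) :
    ‖phiGrad w A t X - phiGrad w A t Y‖ ≤
      t * (1 - t) * β ^ (1 - t) * α ^ (t - 2) * ‖X - Y‖ := by
  have ht : 0 < 1 - t := by linarith
  refine norm_le_of_inner_le (by positivity) (norm_nonneg _) fun Z => ?_
  rw [phiGrad_sub, sum_inner]
  refine (Finset.sum_le_sum fun j _ => ?_).trans_eq
    ((Finset.sum_mul _ _ _).symm.trans (by rw [hw1, one_mul]))
  rw [real_inner_smul_left, norm_sub_rev X Y]
  exact mul_le_mul_of_nonneg_left (inner_fidelityGrad_sub_le ht0 ht1 hα hβ (hA j) hY hX Z) (hw j)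

theorem le_inner_phiGrad_sub (ht0 : 0 < t) (ht1 : t < 1) (hw : ∀ j, 0 ≤ w j)
    (hw1 : ∑ j, w j = 1) (hα : 0 < α) (hβ : 0 < β) (hA : ∀ j, A j ∈ loewnerIcc n α β)
    (hX : X ∈ loewnerIcc n α β) (hY : Y ∈ loewnerIcc n α β) :
    t * (1 - t) * β ^ (t - 2) * α ^ (1 - t) * ‖X - Y‖ ^ 2 ≤
      inner ℝ (phiGrad w A t X - phiGrad w A t Y) (X - Y) := by
  rw [phiGrad_sub, sum_inner]
  refine ((by rw [hw1, one_mul] : _ = _).trans (Finset.sum_mul _ _ _)).trans_le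
    (Finset.sum_le_sum fun j _ => ?_)
  rw [real_inner_smul_left, norm_sub_rev X Y]
  exact mul_le_mul_of_nonneg_left (le_inner_fidelityGrad_sub ht0 ht1 hα hβ (hA j) hY hX) (hw j)

theorem isSmoothOn_phi (ht0 : 0 < t) (ht1 : t < 1) (hw : ∀ j, 0 ≤ w j) (hw1 : ∑ j, w j = 1)
    (hα : 0 < α) (hβ : 0 < β) (hA : ∀ j, A j ∈ loewnerIcc n α β) :
    IsSmoothOn (phi w A t) (t * (1 - t) * β ^ (1 - t) * α ^ (t - 2)) (loewnerIcc n α β) := by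
  have hg : ∀ X ∈ loewnerIcc n α β, HasGradientAt (phi w A t) (phiGrad w A t X) X := fun X hX =>
    hasGradientAt_phi ht0 ht1 w (fun j => loewnerIcc_subset_pos hα (hA j))
      (loewnerIcc_subset_pos hα hX)
  refine ⟨fun X hX => (hg X hX).differentiableAt, fun X hX Y hY => ?_⟩
  rw [(hg X hX).gradient, (hg Y hY).gradient]
  exact norm_phiGrad_sub_le ht0 ht1 hw hw1 hα hβ hA hX hY

theorem isStronglyConvexOn_phi (ht0 : 0 < t) (ht1 : t < 1) (hw : ∀ j, 0 ≤ w j)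
    (hw1 : ∑ j, w j = 1) (hα : 0 < α) (hβ : 0 < β) (hA : ∀ j, A j ∈ loewnerIcc n α β) :
    IsStronglyConvexOn (phi w A t) (t * (1 - t) * β ^ (t - 2) * α ^ (1 - t))
      (loewnerIcc n α β) := by
  have hg : ∀ X ∈ loewnerIcc n α β, HasGradientAt (phi w A t) (phiGrad w A t X) X := fun X hX =>
    hasGradientAt_phi ht0 ht1 w (fun j => loewnerIcc_subset_pos hα (hA j))
      (loewnerIcc_subset_pos hα hX)
  have ht : 0 < 1 - t := by linarith
  refine ⟨by positivity, fun X hX => (hg X hX).differentiableAt, fun X hX Y hY => ?_⟩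
  rw [bregman, (hg X hX).gradient]
  exact bregman_ge_of_strongly_monotone (convex_loewnerIcc α β) hg
    (fun X hX Y hY => le_inner_phiGrad_sub ht0 ht1 hw hw1 hα hβ hA hX hY) hX hY

end LoewnerInterval

end Objective

/-! ### Nonnegativity and strict convexity on the whole cone. -/

section StrictConvexity

variable {n m : ℕ}

/-- Since `A^s A A^s = A^(1/t)`, all powers collapse. The tangent of the fidelity at `A` is thus
`(1-t) tr A + t tr X`, the term it is subtracted from in `φ_t`. -/
theorem fidelity_self {t : ℝ} (ht0 : 0 < t) {A : Herm n} (hA : A ∈ Pos n) :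
    fidelity t A A = (Matrix.trace (Herm.toMat A)).re ∧
      fidelityGrad t A A = t • Herm.one n := by
  have hp : IsStrictlyPositive (Herm.toMat A) := Matrix.PosDef.isStrictlyPositive hA
  have hu := hp.isUnit
  have ht : t⁻¹ ≠ 0 := inv_ne_zero ht0.ne'
  have h1 : Herm.toMat A ^ ((1 - t) / (2 * t)) * Herm.toMat A *
      Herm.toMat A ^ ((1 - t) / (2 * t)) = Herm.toMat A ^ t⁻¹ := by
    nth_rewrite 2 [← CFC.rpow_one (Herm.toMat A) hp.nonneg]
    rw [← CFC.rpow_add hu, ← CFC.rpow_add hu]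
    congr 1
    field_simp
    ring
  refine ⟨?_, ?_⟩
  · rw [fidelity, h1, CFC.rpow_rpow _ _ _ ht hp, inv_mul_cancel₀ ht0.ne', CFC.rpow_one _ hp.nonneg]
  · rw [fidelityGrad]
    congr 1
    refine Herm.toMat_injective ?_
    rw [Herm.toMat_ofMat, h1, CFC.rpow_rpow _ _ _ ht hp, ← CFC.rpow_add hu, ← CFC.rpow_add hu]
    change _ = (1 : Matrix (Fin n) (Fin n) ℂ)
    rw [← CFC.rpow_zero (Herm.toMat A) hp.nonneg]
    congr 1
    field_simp
    ring

theorem phi_nonneg {t : ℝ} (ht0 : 0 < t) (ht1 : t < 1) {w : Fin m → ℝ} (hw : ∀ j, 0 ≤ w j)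
    {A : Fin m → Herm n} (hA : ∀ j, A j ∈ Pos n) {X : Herm n} (hX : X ∈ Pos n) :
    0 ≤ phi w A t X := by
  rw [phi_eq]
  refine Finset.sum_nonneg fun j _ => mul_nonneg (hw j) ?_
  have h := fidelity_le_tangent ht0 ht1 (hA j) (hA j) hX
  rw [(fidelity_self ht0 (hA j)).1, (fidelity_self ht0 (hA j)).2, inner_sub_right] at h
  have h2 : inner ℝ (t • Herm.one n) (A j) = t * (Matrix.trace (Herm.toMat (A j))).re := by
    simp [Herm.inner_def, Herm.one, real_inner_smul_left]
  rw [h2] at h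
  linarith

/-- Stated as an eventuality so that finitely many positive definite matrices can be placed in one
common interval. -/
theorem eventually_mem_loewnerIcc {X : Herm n} (hX : X ∈ Pos n) :
    ∀ᶠ R : ℝ in Filter.atTop, X ∈ loewnerIcc n R⁻¹ R := by
  have hfin : (spectrum ℝ (Herm.toMat X)).Finite := by
    rw [X.isHermitian.spectrum_real_eq_range_eigenvalues]
    exact Set.finite_range _
  have h : ∀ᶠ R : ℝ in Filter.atTop, ∀ x ∈ spectrum ℝ (Herm.toMat X), R⁻¹ ≤ x ∧ x ≤ R := by
    refine (Filter.eventually_all_finite hfin).2 fun x hx => ?_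
    have hx0 := mem_spectrum_pos hX hx
    filter_upwards [Filter.eventually_ge_atTop x, Filter.eventually_ge_atTop x⁻¹] with R h1 h2
    exact ⟨inv_le_of_inv_le₀ hx0 h2, h1⟩
  filter_upwards [h] with R hR
  exact ⟨(smul_one_le_iff X.isHermitian).2 fun x hx => (hR x hx).1,
    (le_smul_one_iff X.isHermitian).2 fun x hx => (hR x hx).2⟩

theorem convex_pos : Convex ℝ (Pos n) := by
  intro X hX Y hY a b ha hb hab
  obtain ⟨R, hR, h1, h2⟩ := ((Filter.eventually_gt_atTop (0 : ℝ)).and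
    ((eventually_mem_loewnerIcc hX).and (eventually_mem_loewnerIcc hY))).exists
  exact loewnerIcc_subset_pos (inv_pos.2 hR) (convex_loewnerIcc _ _ h1 h2 ha hb hab)

theorem phi_gt_tangent {t : ℝ} (ht0 : 0 < t) (ht1 : t < 1) {w : Fin m → ℝ} (hw : ∀ j, 0 ≤ w j)
    (hw1 : ∑ j, w j = 1) {A : Fin m → Herm n} (hA : ∀ j, A j ∈ Pos n) {X Y : Herm n}
    (hX : X ∈ Pos n) (hY : Y ∈ Pos n) (hXY : X ≠ Y) :
    phi w A t X + inner ℝ (phiGrad w A t X) (Y - X) < phi w A t Y := by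
  obtain ⟨R, hR, h1, h2, h3⟩ := ((Filter.eventually_gt_atTop (0 : ℝ)).and
    ((eventually_mem_loewnerIcc hX).and ((eventually_mem_loewnerIcc hY).and
      (Filter.eventually_all.2 fun j => eventually_mem_loewnerIcc (hA j))))).exists
  obtain ⟨hk, -, h⟩ := isStronglyConvexOn_phi ht0 ht1 hw hw1 (inv_pos.2 hR) hR h3
  have h4 := h X h1 Y h2
  rw [bregman, (hasGradientAt_phi ht0 ht1 w hA hX).gradient] at h4
  have h5 : 0 < ‖X - Y‖ := norm_pos_iff.2 (sub_ne_zero.2 hXY)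
  have h6 := mul_pos (half_pos hk) (pow_pos h5 2)
  linarith

theorem strictConvexOn_phi {t : ℝ} (ht0 : 0 < t) (ht1 : t < 1) {w : Fin m → ℝ}
    (hw : ∀ j, 0 ≤ w j) (hw1 : ∑ j, w j = 1) {A : Fin m → Herm n} (hA : ∀ j, A j ∈ Pos n) :
    StrictConvexOn ℝ (Pos n) (phi w A t) := by
  refine ⟨convex_pos, fun X hX Y hY hXY a b ha hb hab => ?_⟩
  have hZ := convex_pos hX hY ha.le hb.le hab
  set Z := a • X + b • Y with hZdef
  have eX : X - Z = b • (X - Y) := by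
    rw [hZdef, eq_sub_of_add_eq hab]
    module
  have eY : Y - Z = (-a) • (X - Y) := by
    rw [hZdef, eq_sub_of_add_eq' hab]
    module
  have hne : X - Y ≠ 0 := sub_ne_zero.2 hXY
  have h1 := phi_gt_tangent ht0 ht1 hw hw1 hA hZ hX
    (fun h => smul_ne_zero hb.ne' hne (by rw [← eX, h, sub_self]))
  have h2 := phi_gt_tangent ht0 ht1 hw hw1 hA hZ hY
    (fun h => smul_ne_zero (neg_ne_zero.2 ha.ne') hne (by rw [← eY, h, sub_self]))
  rw [eX, inner_smul_right] at h1
  rw [eY, inner_smul_right] at h2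
  -- With weights `a` and `b` the linear terms of the two tangent inequalities cancel.
  have h3 := mul_lt_mul_of_pos_left h1 ha
  have h4 := mul_lt_mul_of_pos_left h2 hb
  simp only [smul_eq_mul]
  have e : phi w A t Z = a * phi w A t Z + b * phi w A t Z := by rw [← add_mul, hab, one_mul]
  rw [e]
  linarith

end StrictConvexity

/-! ### Existence of a critical point in the interval. -/

section Minimizer

variable {n m : ℕ}

open scoped Matrix.Norms.L2Operator in
theorem isClosed_loewnerIcc (α β : ℝ) : IsClosed (loewnerIcc n α β) := by
  have h : IsClosed (Set.Icc (α • (1 : Matrix (Fin n) (Fin n) ℂ)) (β • 1)) := isClosed_Icc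
  exact h.preimage (LinearMap.continuous_of_finiteDimensional (Herm.toMat (n := n)))

theorem isCompact_loewnerIcc {α β : ℝ} (hα : 0 < α) (hβ : 0 < β) :
    IsCompact (loewnerIcc n α β) := by
  refine Metric.isCompact_of_isClosed_isBounded (isClosed_loewnerIcc α β) ?_
  rw [isBounded_iff_forall_norm_le]
  -- `tr X² ≤ β tr X ≤ β² n`; the maximum with `1` makes the bound on `‖X‖²` a bound on `‖X‖`.
  refine ⟨max (β * (β * n)) 1, fun X hX => ?_⟩
  have hXp : (Herm.toMat X).PosSemidef :=
    Matrix.PosDef.posSemidef (loewnerIcc_subset_pos hα hX)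
  have h1 := trace_mul_le_trace_mul hX.2 hXp
  have h2 := trace_mul_le_trace_mul hX.2 (Matrix.PosSemidef.one (n := Fin n) (R := ℂ))
  rw [← Herm.norm_sq_eq, smul_mul_assoc, one_mul, Matrix.trace_smul, Complex.smul_re,
    smul_eq_mul] at h1
  rw [mul_one, mul_one, Matrix.trace_smul, Complex.smul_re, smul_eq_mul, Matrix.trace_one,
    Complex.natCast_re, Fintype.card_fin] at h2
  have h3 : ‖X‖ ^ 2 ≤ max (β * (β * n)) 1 :=
    (h1.trans (mul_le_mul_of_nonneg_left h2 hβ.le)).trans (le_max_left _ _)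
  have h4 : (1 : ℝ) ≤ max (β * (β * n)) 1 := le_max_right _ _
  nlinarith [norm_nonneg X]

theorem fixMap_isHermitian (w : Fin m → ℝ) (A : Fin m → Herm n) (t : ℝ) (X : Herm n) :
    (fixMap w A t X).IsHermitian :=
  isSelfAdjoint_sum _ fun _ _ => IsSelfAdjoint.smul (IsSelfAdjoint.all _) (rpow_isHermitian _ _)

/-- Each sandwiched matrix lies between `α^(1/t)` and `β^(1/t)`. The bounds are scalar, so the
`t`-th power is taken on the spectrum, without operator monotonicity. -/
theorem fixMap_mem_loewnerIcc {t : ℝ} (ht0 : 0 < t) (ht1 : t < 1) {w : Fin m → ℝ}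
    (hw : ∀ j, 0 ≤ w j) (hw1 : ∑ j, w j = 1) {A : Fin m → Herm n} {α β : ℝ} (hα : 0 < α)
    (hβ : 0 < β) (hA : ∀ j, A j ∈ loewnerIcc n α β) {X : Herm n} (hX : X ∈ loewnerIcc n α β) :
    Herm.ofMat (fixMap w A t X) (fixMap_isHermitian w A t X) ∈ loewnerIcc n α β := by
  have hXp : (Herm.toMat X).PosDef := loewnerIcc_subset_pos hα hX
  have hS := rpow_posDef hXp (1 / 2)
  have hSS : Herm.toMat X ^ (1 / 2 : ℝ) * Herm.toMat X ^ (1 / 2 : ℝ) = Herm.toMat X := by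
    rw [← CFC.rpow_add hXp.isUnit]
    norm_num [CFC.rpow_one _ hXp.isStrictlyPositive.nonneg]
  have hr : 0 ≤ (1 - t) / t := div_nonneg (by linarith) ht0.le
  have hpow : ∀ a : ℝ, 0 < a → a ^ ((1 - t) / t) * a = a ^ t⁻¹ := fun a ha => by
    rw [← Real.rpow_add_one ha.ne']
    congr 1
    field_simp
    ring
  have hpow2 : ∀ a : ℝ, 0 < a → (a ^ t⁻¹) ^ t = a := fun a ha => by
    rw [← Real.rpow_mul ha.le, inv_mul_cancel₀ ht0.ne', Real.rpow_one]
  have hone : ∀ a : ℝ, ∑ j, w j • (a • (1 : Matrix (Fin n) (Fin n) ℂ)) = a • 1 := fun a => by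
    rw [← Finset.sum_smul, hw1, one_smul]
  have hsm : ∀ (r : ℝ) {P Q : Matrix (Fin n) (Fin n) ℂ}, 0 ≤ r → P ≤ Q → r • P ≤ r • Q := by
    intro r P Q hr h
    have := (Matrix.le_iff.1 h).smul hr
    rw [Matrix.le_iff, ← smul_sub]
    exact this
  have hterm : ∀ j, α • (1 : Matrix (Fin n) (Fin n) ℂ) ≤ (Herm.toMat X ^ (1 / 2 : ℝ) *
        Herm.toMat (A j) ^ ((1 - t) / t) * Herm.toMat X ^ (1 / 2 : ℝ)) ^ t ∧
      (Herm.toMat X ^ (1 / 2 : ℝ) * Herm.toMat (A j) ^ ((1 - t) / t) *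
        Herm.toMat X ^ (1 / 2 : ℝ)) ^ t ≤ β • (1 : Matrix (Fin n) (Fin n) ℂ) := by
    intro j
    have hAp : (Herm.toMat (A j)).PosDef := loewnerIcc_subset_pos hα (hA j)
    have hP := posDef_mul_mul hS (rpow_posDef hAp ((1 - t) / t))
    have h1 := conj_le_conj (smul_one_le_rpow hAp (s := (1 - t) / t) fun x hx =>
      Real.rpow_le_rpow hα.le ((smul_one_le_iff (A j).isHermitian).1 (hA j).1 x hx) hr) hS.isHermitian
    have h2 := conj_le_conj (rpow_le_smul_one hAp (s := (1 - t) / t) fun x hx =>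
      Real.rpow_le_rpow (mem_spectrum_pos hAp hx).le
        ((le_smul_one_iff (A j).isHermitian).1 (hA j).2 x hx) hr) hS.isHermitian
    rw [mul_smul_comm, mul_one, smul_mul_assoc, hSS] at h1 h2
    have h3 := (hsm _ (Real.rpow_nonneg hα.le _) hX.1).trans h1
    have h4 := h2.trans (hsm _ (Real.rpow_nonneg hβ.le _) hX.2)
    rw [smul_smul, hpow _ hα] at h3
    rw [smul_smul, hpow _ hβ] at h4
    refine ⟨smul_one_le_rpow hP fun x hx => ?_, rpow_le_smul_one hP fun x hx => ?_⟩
    · rw [← hpow2 α hα]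
      exact Real.rpow_le_rpow (Real.rpow_nonneg hα.le _) ((smul_one_le_iff hP.isHermitian).1 h3 x hx)
        ht0.le
    · rw [← hpow2 β hβ]
      exact Real.rpow_le_rpow (mem_spectrum_pos hP hx).le
        ((le_smul_one_iff hP.isHermitian).1 h4 x hx) ht0.le
  constructor
  · rw [Herm.toMat_ofMat, ← hone α]
    exact Finset.sum_le_sum fun j _ => hsm _ (hw j) (hterm j).1
  · rw [Herm.toMat_ofMat, ← hone β]
    exact Finset.sum_le_sum fun j _ => hsm _ (hw j) (hterm j).2

theorem sqrt_mul_phiGrad_mul_sqrt {t : ℝ} (ht0 : 0 < t) {w : Fin m → ℝ} (hw1 : ∑ j, w j = 1)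
    {A : Fin m → Herm n} (hA : ∀ j, A j ∈ Pos n) {X : Herm n} (hX : X ∈ Pos n) :
    Herm.toMat X ^ (1 / 2 : ℝ) * Herm.toMat (phiGrad w A t X) * Herm.toMat X ^ (1 / 2 : ℝ) =
      t • (Herm.toMat X - fixMap w A t X) := by
  have hXp : (Herm.toMat X).PosDef := hX
  have hS := rpow_posDef hXp (1 / 2)
  have hSS : Herm.toMat X ^ (1 / 2 : ℝ) * Herm.toMat X ^ (1 / 2 : ℝ) = Herm.toMat X := by
    rw [← CFC.rpow_add hXp.isUnit]
    norm_num [CFC.rpow_one _ hXp.isStrictlyPositive.nonneg]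
  set S := Herm.toMat X ^ (1 / 2 : ℝ) with hSdef
  have hterm : ∀ j, S * Herm.toMat (fidelityGrad t (A j) X) * S =
      t • (S * Herm.toMat (A j) ^ ((1 - t) / t) * S) ^ t := by
    intro j
    have hAp : (Herm.toMat (A j)).PosDef := hA j
    have hB := rpow_posDef hAp ((1 - t) / (2 * t))
    have hBB : Herm.toMat (A j) ^ ((1 - t) / (2 * t)) * Herm.toMat (A j) ^ ((1 - t) / (2 * t)) =
        Herm.toMat (A j) ^ ((1 - t) / t) := by
      rw [← CFC.rpow_add hAp.isUnit]
      congr 1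
      field_simp
      ring
    rw [fidelityGrad, map_smul, Herm.toMat_ofMat, ← hBB]
    set B := Herm.toMat (A j) ^ ((1 - t) / (2 * t))
    -- Applied to `K = B S`, for which `K K* = B X B` and `K* K = S B² S`.
    have h := star_mul_rpow_mul (hB.isUnit.mul hS.isUnit) t
    rw [star_mul, show star B = B from hB.isHermitian, show star S = S from hS.isHermitian,
      show B * S * (S * B) = B * (S * S) * B by simp only [mul_assoc], hSS] at h
    rw [mul_smul_comm, smul_mul_assoc, show S * (B * B) * S = S * B * (B * S) by
      simp only [mul_assoc], ← h]
    simp only [mul_assoc]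
  have hone : Herm.toMat (Herm.one n) = 1 := rfl
  rw [phiGrad, map_sum, Finset.mul_sum, Finset.sum_mul, fixMap, smul_sub, Finset.smul_sum]
  have h2 : t • Herm.toMat X = ∑ j, w j • t • Herm.toMat X := by
    rw [← Finset.sum_smul, hw1, one_smul]
  rw [h2, ← Finset.sum_sub_distrib]
  refine Finset.sum_congr rfl fun j _ => ?_
  rw [map_smul, map_sub, map_smul, hone, mul_smul_comm, smul_mul_assoc, mul_sub, sub_mul, hterm,
    mul_smul_comm, mul_one, smul_mul_assoc, hSS, smul_sub, smul_comm (w j) t (_ ^ t)]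

/-- The minimum may lie on the boundary of the interval, so only a variational inequality is
available. Testing it in the direction of the image under `fixMap` suffices. -/
theorem phiGrad_eq_zero_of_isMinOn {t : ℝ} (ht0 : 0 < t) (ht1 : t < 1) {w : Fin m → ℝ}
    (hw : ∀ j, 0 ≤ w j) (hw1 : ∑ j, w j = 1) {A : Fin m → Herm n} {α β : ℝ} (hα : 0 < α)
    (hβ : 0 < β) (hA : ∀ j, A j ∈ loewnerIcc n α β) {X : Herm n} (hX : X ∈ loewnerIcc n α β)
    (hmin : IsMinOn (phi w A t) (loewnerIcc n α β) X) : phiGrad w A t X = 0 := by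
  have hXp : (Herm.toMat X).PosDef := loewnerIcc_subset_pos hα hX
  have hAp := fun j => loewnerIcc_subset_pos hα (hA j)
  have hY := fixMap_mem_loewnerIcc ht0 ht1 hw hw1 hα hβ hA hX
  set Y := Herm.ofMat (fixMap w A t X) (fixMap_isHermitian w A t X) with hYdef
  have hvar : 0 ≤ inner ℝ (phiGrad w A t X) (Y - X) := by
    have h := hmin.localize.hasFDerivWithinAt_nonneg
      (hasGradientAt_phi ht0 ht1 w hAp (X := X) hXp).hasFDerivAt.hasFDerivWithinAt
      (y := Y - X) (mem_posTangentConeAt_of_segment_subset (by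
        rw [add_sub_cancel]; exact (convex_loewnerIcc α β).segment_subset hX hY))
    simpa using h
  have hconj := sqrt_mul_phiGrad_mul_sqrt ht0 hw1 hAp (X := X) hXp
  have hR := rpow_posDef hXp (1 / 4)
  have hRR : Herm.toMat X ^ (1 / 4 : ℝ) * Herm.toMat X ^ (1 / 4 : ℝ) =
      Herm.toMat X ^ (1 / 2 : ℝ) := by
    rw [← CFC.rpow_add hXp.isUnit]
    norm_num
  rw [← hRR] at hconj
  set R := Herm.toMat X ^ (1 / 4 : ℝ)
  set G := Herm.toMat (phiGrad w A t X) with hG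
  have hW : (R * G * R).IsHermitian :=
    mul_mul_isHermitian hR.isHermitian (phiGrad w A t X).isHermitian
  -- Splitting `X^(1/2)` into two factors `R = X^(1/4)` makes the trace a square by cyclicity.
  have hnorm : ‖Herm.ofMat (R * G * R) hW‖ ^ 2 = -(t * inner ℝ (phiGrad w A t X) (Y - X)) := by
    have h1 : t • Herm.toMat (Y - X) = -(R * R * G * (R * R)) := by
      rw [hconj, map_sub, hYdef, Herm.toMat_ofMat, ← smul_neg, neg_sub]
    have h2 : t * inner ℝ (phiGrad w A t X) (Y - X) =
        (Matrix.trace (G * (t • Herm.toMat (Y - X)))).re := by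
      rw [← inner_smul_right, Herm.inner_def, map_smul]
    rw [h2, h1, mul_neg, Matrix.trace_neg, Complex.neg_re, neg_neg, Herm.norm_sq_eq,
      Herm.toMat_ofMat, show R * G * R * (R * G * R) = R * (G * R * R * G * R) by
        simp only [mul_assoc], Matrix.trace_mul_comm]
    simp only [mul_assoc]
  have h0 : ‖Herm.ofMat (R * G * R) hW‖ = 0 := by
    refine pow_eq_zero_iff two_ne_zero |>.1 (le_antisymm ?_ (sq_nonneg _))
    rw [hnorm]
    exact neg_nonpos.2 (mul_nonneg ht0.le hvar)
  have h1 : R * G * R = 0 := by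
    have := congrArg Herm.toMat (norm_eq_zero.1 h0)
    simpa using this
  have h2 : G = 0 := by
    rw [hR.isUnit.mul_left_eq_zero] at h1
    rwa [hR.isUnit.mul_right_eq_zero] at h1
  exact Herm.toMat_injective (by rw [map_zero, ← hG, h2])

end Minimizer

end SandwichedEntropy

end

/-! ### Assembly of the statement. -/

theorem corollaryC (n m : ℕ) (t : ℝ) (ht0 : 0 < t) (ht1 : t < 1)
    (w : Fin m → ℝ) (hw : ∀ j, 0 ≤ w j) (hw1 : ∑ j, w j = 1)
    (A : Fin m → SandwichedEntropy.Herm n) (hA : ∀ j, A j ∈ SandwichedEntropy.Pos n) :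
    -- the function is nonnegative, smooth and strictly convex on the positive definite matrices
    (∀ X ∈ SandwichedEntropy.Pos n, 0 ≤ SandwichedEntropy.phi w A t X) ∧
    ContDiffOn ℝ ∞ (SandwichedEntropy.phi w A t) (SandwichedEntropy.Pos n) ∧
    StrictConvexOn ℝ (SandwichedEntropy.Pos n) (SandwichedEntropy.phi w A t) ∧
    -- for all bounds of the given matrices, it is smooth and strongly convex on the interval
    (∀ α β : ℝ, 0 < α → 0 < β → (∀ j, A j ∈ SandwichedEntropy.loewnerIcc n α β) →
      SandwichedEntropy.IsSmoothOn (SandwichedEntropy.phi w A t)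
        (t * (1 - t) * β ^ (1 - t) * α ^ (t - 2)) (SandwichedEntropy.loewnerIcc n α β) ∧
      SandwichedEntropy.IsStronglyConvexOn (SandwichedEntropy.phi w A t)
        (t * (1 - t) * β ^ (t - 2) * α ^ (1 - t)) (SandwichedEntropy.loewnerIcc n α β)) ∧
    -- it has a unique minimizer, which is a fixed point lying in every such interval
    ∃ X₀ ∈ SandwichedEntropy.Pos n,
      IsMinOn (SandwichedEntropy.phi w A t) (SandwichedEntropy.Pos n) X₀ ∧
      (∀ X ∈ SandwichedEntropy.Pos n,
        IsMinOn (SandwichedEntropy.phi w A t) (SandwichedEntropy.Pos n) X → X = X₀) ∧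
      SandwichedEntropy.fixMap w A t X₀ = SandwichedEntropy.Herm.toMat X₀ ∧
      ∀ α β : ℝ, 0 < α → 0 < β → (∀ j, A j ∈ SandwichedEntropy.loewnerIcc n α β) →
        X₀ ∈ SandwichedEntropy.loewnerIcc n α β := by
  have hgrad : ∀ α β : ℝ, 0 < α → 0 < β →
      (∀ j, A j ∈ SandwichedEntropy.loewnerIcc n α β) →
      ∃ X ∈ SandwichedEntropy.loewnerIcc n α β, SandwichedEntropy.phiGrad w A t X = 0 := by
    intro α β hα hβ hA'
    -- Weights summing to `1` require an index, and the corresponding `A j` shows that the interval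
    -- is nonempty.
    have hne : Nonempty (Fin m) := by
      by_contra h
      rw [not_nonempty_iff] at h
      simp at hw1
    obtain ⟨X, hX, hmin⟩ := (SandwichedEntropy.isCompact_loewnerIcc (n := n) hα hβ).exists_isMinOn
      ⟨A hne.some, hA' hne.some⟩ (f := SandwichedEntropy.phi w A t) fun X hX =>
        (SandwichedEntropy.contDiffAt_phi w hA t
          (SandwichedEntropy.loewnerIcc_subset_pos hα hX)).continuousAt.continuousWithinAt
    exact ⟨X, hX, SandwichedEntropy.phiGrad_eq_zero_of_isMinOn ht0 ht1 hw hw1 hα hβ hA' hX hmin⟩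
  have hglobal : ∀ X ∈ SandwichedEntropy.Pos n, SandwichedEntropy.phiGrad w A t X = 0 →
      IsMinOn (SandwichedEntropy.phi w A t) (SandwichedEntropy.Pos n) X := by
    intro X hX h0 Y hY
    have h := SandwichedEntropy.phi_ge_tangent ht0 ht1 hw hA hX hY
    rwa [h0, inner_zero_left, add_zero] at h
  have hstrict := SandwichedEntropy.strictConvexOn_phi ht0 ht1 hw hw1 hA
  refine ⟨fun X hX => SandwichedEntropy.phi_nonneg ht0 ht1 hw hA hX,
    fun X hX => (SandwichedEntropy.contDiffAt_phi w hA t hX).contDiffWithinAt, hstrict,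
    fun α β hα hβ hA' => ⟨SandwichedEntropy.isSmoothOn_phi ht0 ht1 hw hw1 hα hβ hA',
      SandwichedEntropy.isStronglyConvexOn_phi ht0 ht1 hw hw1 hα hβ hA'⟩, ?_⟩
  obtain ⟨R, hR, hAR⟩ := ((Filter.eventually_gt_atTop (0 : ℝ)).and
    (Filter.eventually_all.2 fun j => SandwichedEntropy.eventually_mem_loewnerIcc (hA j))).exists
  obtain ⟨X, hX, h0⟩ := hgrad R⁻¹ R (inv_pos.2 hR) hR hAR
  have hXp := SandwichedEntropy.loewnerIcc_subset_pos (inv_pos.2 hR) hX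
  refine ⟨X, hXp, hglobal X hXp h0,
    fun Y hY hmin => hstrict.eq_of_isMinOn hmin (hglobal X hXp h0) hY hXp, ?_, ?_⟩
  · have h := SandwichedEntropy.sqrt_mul_phiGrad_mul_sqrt ht0 hw1 hA hXp
    rw [h0, map_zero, mul_zero, zero_mul] at h
    exact (sub_eq_zero.1 ((smul_eq_zero.1 h.symm).resolve_left ht0.ne')).symm
  · intro α β hα hβ hA'
    -- Every admissible interval contains a critical point, which is a global minimizer and so
    -- equals `X` by strict convexity.
    obtain ⟨Y, hY, hY0⟩ := hgrad α β hα hβ hA'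
    have hYp := SandwichedEntropy.loewnerIcc_subset_pos hα hY
    rwa [hstrict.eq_of_isMinOn (hglobal X hXp h0) (hglobal Y hYp hY0) hXp hYp]
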